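/- Let $n\ge 1$, $d=n+1$, $m>0$, and write $x\cdot y=x_0y_0-\sum_{i=1}^n x_iy_i$ for the Lorentzian scalar product on $\mathbb R^d$. Let $\omega_{\mathbf p}=(\mathbf p^2+m^2)^{1/2}$, $d\mu(\mathbf p)=d^n\mathbf p/(2\omega_{\mathbf p})$, $\mathscr H_1=L^2(\mathbb R^n,d\mu)$, and let $\mathscr H=\bigoplus_{k\ge0}\mathscr H_k$ be the bosonic Fock space over $\mathscr H_1$, where $\mathscr H_k$ is the $k$-fold symmetric Hilbert tensor power of $\mathscr H_1$. On vectors of finite particle number let $N$ be the particle number operator, $a^*(h)$ and $a(h)=a^*(h)^*$ ($h\in\mathscr H_1$) the creation and annihilation operators ($a^*(h)\Psi=\sqrt{k+1}\,P_{k+1}(h\otimes\Psi)$ for $\Psi\in\mathscr H_k$, with $P_{k+1}$ the orthogonal projection onto $\mathscr H_{k+1}$), and $\Gamma(W)=\bigoplus_k W^{\otimes k}$ the second quantization of a unitary $W$ on $\mathscr H_1$. For $f\in\mathscr S(\mathbb R^d)$ put $f^\pm(\mathbf p)=\int dx\,f(x)e^{\pm ip\cdot x}$ with $p=(\omega_{\mathbf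 p},\mathbf p)$, considered as elements of $\mathscr H_1$, and let $\phi(f)=a(\overline{f^-})+a^*(f^+)$ be the free scalar field of mass $m$. Let $P=(P_\mu)$ be the second quantized momentum operator, so that $e^{iy\cdot P}=\Gamma(e^{iy\cdot p})$, where $e^{iy\cdot p}$ acts on $\mathscr H_1$ by multiplication. Let $V$ be a unitary operator on $\mathscr H_1$, $X_\mu=\Gamma(V^{-1})P_\mu\Gamma(V)$, and $V(y)=e^{iy\cdot X}=\Gamma(V^{-1})e^{iy\cdot P}\Gamma(V)$ for $y\in\mathbb R^d$. Let $\Delta(P)$ be the set of all $\psi\in\mathscr H_1$ such that $(\mathbf p^2)^r\psi(\mathbf p)$ is (essentially) bounded for every $r=0,1,2,\dots$; let $\Delta_k(P)\subset\mathscr H_k$ be the linear span of the symmetrized products of $k$ elements of $\Delta(P)$, $\Delta_k(X)=\Gamma(V^{-1})\Delta_k(P)$, and $\Delta(X)$ the algebraic direct sum of the spaces $\Delta_k(X)$, $k\ge0$. Let $\theta$ be a real $d\times d$ matrix that is skew-symmetric with respect to the Lorentzian scalar product. Then the deformed operators $a_{\theta,X}(\overline{f^-})$, $a^*_{\theta,X}(f^+)$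 and $\phi_{\theta,X}(f)$ are well defined linear operators from $\Delta(X)$ to $\mathscr H$: for $A=a(\overline{f^-})$, $A=a^*(f^+)$ and $A=\phi(f)$, for every $\Phi\in\Delta(X)$ (in particular for every $\Phi\in\Delta_k(X)$) and every $\chi\in\mathscr S(\mathbb R^d\times\mathbb R^d)$ with $\chi(0,0)=1$, the integrals below exist for all $\varepsilon\ne0$, and the limit $$A_{\theta,X}\Phi=(2\pi)^{-d}\lim_{\varepsilon\to0}\iint dx\,dy\;e^{-ix\cdot y}\,\chi(\varepsilon x,\varepsilon y)\,V(\theta x)\,A\,V(\theta x)^{-1}\,V(y)\Phi$$ exists in the norm of $\mathscr H$, does not depend on $\chi$, and is linear in $\Phi$. Moreover $\phi_{\theta,X}(f)\Phi=a_{\theta,X}(\overline{f^-})\Phi+a^*_{\theta,X}(f^+)\Phi$, and the bounds of the free field hold: with $\Psi=\Gamma(V)\Phi$, $$\|a_{\theta,X}(\overline{f^-})\Phi\|\le\|f^-\|\,\|(N+1)^{1/2}\Phi\|,\qquad \|a^*_{\theta,X}(f^+)\Phi\|\le\|f^+\|\,\|(N+1)^{1/2}\Phi\|,$$ $$\|\phi_{\theta,X}(f)\Phi\|\le\big(\|f^+\|+\|f^-\|\big)\,\|(N+1)^{1/2}\Psi\|,\qquad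 \|(N+1)^{1/2}\Psi\|=\|(N+1)^{1/2}\Phi\|.$$ -/

import Mathlib

open MeasureTheory Filter Topology
open scoped ENNReal SchwartzMap InnerProductSpace FourierTransform

noncomputable section

namespace DeformedField

/-! ### Bosonic Fock space over `L²(α, μ)` -/

section Fock

variable {α : Type*} [MeasurableSpace α] (μ : Measure α) [SigmaFinite μ]

/-- The `k`-fold product measure. -/
abbrev piMeasure (k : ℕ) : Measure (Fin k → α) := Measure.pi fun _ : Fin k => μ

/-- The one-particle space `L²(α, μ)`. -/
abbrev OneParticle : Type _ := Lp ℂ 2 μ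

/-- The space of (not necessarily symmetric) `k`-particle wave functions `L²(αᵏ, μᵏ)`. -/
abbrev WaveFunction (k : ℕ) : Type _ := Lp ℂ 2 (piMeasure μ k)

variable {μ}

lemma aestronglyMeasurable_eval {k : ℕ} {f : α → ℂ} (hf : AEStronglyMeasurable f μ) (i : Fin k) :
    AEStronglyMeasurable (fun p : Fin k → α => f (p i)) (piMeasure μ k) :=
  hf.comp_quasiMeasurePreserving (Measure.quasiMeasurePreserving_eval (fun _ : Fin k => μ) i)

lemma memLp_prod {k : ℕ} (f : Fin k → OneParticle μ) :
    MemLp (fun p : Fin k → α => ∏ i, f i (p i)) 2 (piMeasure μ k) := by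
  have hm : AEStronglyMeasurable (fun p : Fin k → α => ∏ i, f i (p i)) (piMeasure μ k) := by
    have := Finset.aestronglyMeasurable_prod (μ := piMeasure μ k) (M := ℂ) Finset.univ
      (f := fun i p => f i (p i))
      fun i _ => aestronglyMeasurable_eval (Lp.aestronglyMeasurable (f i)) i
    refine this.congr (Eventually.of_forall fun p => ?_)
    simp
  rw [memLp_two_iff_integrable_sq_norm hm]
  have := Integrable.fintype_prod (μ := fun _ : Fin k => μ) (𝕜 := ℝ)
    (f := fun i x => ‖f i x‖ ^ 2)
    fun i => (memLp_two_iff_integrable_sq_norm (Lp.aestronglyMeasurable (f i))).1 (Lp.memLp (f i))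
  refine this.congr (Eventually.of_forall fun p => ?_)
  simp [Finset.prod_pow]

/-- The product wave function `(f₁ ⊗ ⋯ ⊗ f_k)(p₁, …, p_k) = f₁(p₁) ⋯ f_k(p_k)`. -/
def tensorProd {k : ℕ} (f : Fin k → OneParticle μ) : WaveFunction μ k :=
  (memLp_prod f).toLp _

lemma inner_tensorProd {k : ℕ} (f g : Fin k → OneParticle μ) :
    ⟪tensorProd f, tensorProd g⟫_ℂ = ∏ i, ⟪f i, g i⟫_ℂ := by
  have h : (fun p : Fin k → α => ⟪tensorProd f p, tensorProd g p⟫_ℂ)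
      =ᵐ[piMeasure μ k] fun p => ∏ i, ⟪f i (p i), g i (p i)⟫_ℂ := by
    filter_upwards [(memLp_prod f).coeFn_toLp, (memLp_prod g).coeFn_toLp] with p hf hg
    simp only [tensorProd, hf, hg, RCLike.inner_apply, map_prod, Finset.prod_mul_distrib]
  rw [L2.inner_def, integral_congr_ae h]
  rw [integral_fintype_prod_eq_prod (μ := fun _ : Fin k => μ)
    (fun i x => ⟪f i x, g i x⟫_ℂ)]
  simp [L2.inner_def]

/-- The symmetrised product `(1 / k!) ∑_σ f_{σ(1)} ⊗ ⋯ ⊗ f_{σ(k)}`. -/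
def symProd {k : ℕ} (f : Fin k → OneParticle μ) : WaveFunction μ k :=
  ((k.factorial : ℂ)⁻¹) • ∑ σ : Equiv.Perm (Fin k), tensorProd fun i => f (σ i)

variable (μ)

/-- The bosonic `k`-particle space: the closed linear span, inside `L²(αᵏ, μᵏ)`, of the symmetrised
products, i.e. the `k`-fold symmetric Hilbert tensor power of `L²(α, μ)`. -/
def symSubspace (k : ℕ) : Submodule ℂ (WaveFunction μ k) :=
  (Submodule.span ℂ (Set.range (symProd : (Fin k → OneParticle μ) → WaveFunction μ k))).topologicalClosure

/-- The bosonic `k`-particle Hilbert space. -/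
abbrev Sector (k : ℕ) : Type _ := symSubspace μ k

instance (k : ℕ) : CompleteSpace (Sector μ k) :=
  (Submodule.isClosed_topologicalClosure _).completeSpace_coe

/-- The bosonic Fock space, the Hilbert sum of the sectors. -/
abbrev Fock : Type _ := lp (fun k : ℕ => Sector μ k) 2

variable {μ}

/-- The symmetrised product, as an element of the sector. -/
def symVec {k : ℕ} (f : Fin k → OneParticle μ) : Sector μ k :=
  ⟨symProd f, Submodule.le_topologicalClosure _ (Submodule.subset_span ⟨f, rfl⟩)⟩

/-! ### Second quantization of isometries -/

variable (μ) in
/-- The formal linear combinations of symmetrised products, mapped to the sector. -/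
def combi (k : ℕ) : ((Fin k → OneParticle μ) →₀ ℂ) →ₗ[ℂ] Sector μ k :=
  Finsupp.linearCombination ℂ symVec

lemma denseRange_combi (k : ℕ) : DenseRange (combi μ k) := by
  intro x
  rw [Metric.mem_closure_iff]
  intro ε hε
  have hx : (x : WaveFunction μ k) ∈ closure
      ((Submodule.span ℂ (Set.range (symProd : (Fin k → OneParticle μ) → WaveFunction μ k)) :
        Submodule ℂ (WaveFunction μ k)) : Set (WaveFunction μ k)) := x.2
  obtain ⟨y, hy, hxy⟩ := Metric.mem_closure_iff.1 hx ε hε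
  obtain ⟨c, rfl⟩ := (Finsupp.mem_span_range_iff_exists_finsupp).1 hy
  refine ⟨_, ⟨c, rfl⟩, ?_⟩
  have : ((combi μ k c : Sector μ k) : WaveFunction μ k) = c.sum fun f a => a • symProd f := by
    simp [combi, Finsupp.linearCombination_apply, Finsupp.sum, symVec]
  rw [Subtype.dist_eq, this]
  exact hxy

/-- The prescription `S(f₁ ⊗ ⋯ ⊗ f_k) ↦ S(W f₁ ⊗ ⋯ ⊗ W f_k)` on formal linear combinations. -/
def combiMap (W : OneParticle μ →ₗᵢ[ℂ] OneParticle μ) (k : ℕ) :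
    ((Fin k → OneParticle μ) →₀ ℂ) →ₗ[ℂ] Sector μ k :=
  Finsupp.linearCombination ℂ fun f => symVec fun i => W (f i)

lemma inner_symVec_map (W : OneParticle μ →ₗᵢ[ℂ] OneParticle μ) {k : ℕ}
    (f g : Fin k → OneParticle μ) :
    ⟪symVec fun i => W (f i), symVec fun i => W (g i)⟫_ℂ = ⟪symVec f, symVec g⟫_ℂ := by
  simp only [symVec, Submodule.coe_inner, symProd, inner_smul_left, inner_smul_right, sum_inner,
    inner_sum, inner_tensorProd, LinearIsometry.inner_map_map]

lemma norm_combiMap (W : OneParticle μ →ₗᵢ[ℂ] OneParticle μ) (k : ℕ)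
    (c : (Fin k → OneParticle μ) →₀ ℂ) : ‖combiMap W k c‖ = ‖combi μ k c‖ := by
  rw [@norm_eq_sqrt_re_inner ℂ, @norm_eq_sqrt_re_inner ℂ]
  congr 2
  simp only [combiMap, combi, Finsupp.linearCombination_apply, Finsupp.sum, sum_inner, inner_sum,
    inner_smul_left, inner_smul_right, inner_symVec_map]

/-- `W ⊗ ⋯ ⊗ W` on the `k`-particle sector: the unique bounded operator with
`S(f₁ ⊗ ⋯ ⊗ f_k) ↦ S(W f₁ ⊗ ⋯ ⊗ W f_k)`. -/
def sectorGamma (W : OneParticle μ →ₗᵢ[ℂ] OneParticle μ) (k : ℕ) : Sector μ k →L[ℂ] Sector μ k :=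
  (combiMap W k).extendOfNorm (combi μ k)

lemma sectorGamma_combi (W : OneParticle μ →ₗᵢ[ℂ] OneParticle μ) (k : ℕ)
    (c : (Fin k → OneParticle μ) →₀ ℂ) : sectorGamma W k (combi μ k c) = combiMap W k c :=
  LinearMap.extendOfNorm_eq (denseRange_combi k) ⟨1, fun x => by rw [norm_combiMap, one_mul]⟩ c

lemma sectorGamma_symVec (W : OneParticle μ →ₗᵢ[ℂ] OneParticle μ) {k : ℕ}
    (f : Fin k → OneParticle μ) : sectorGamma W k (symVec f) = symVec fun i => W (f i) := by
  have := sectorGamma_combi W k (Finsupp.single f 1)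
  simpa [combi, combiMap] using this

lemma norm_sectorGamma (W : OneParticle μ →ₗᵢ[ℂ] OneParticle μ) (k : ℕ) (Ψ : Sector μ k) :
    ‖sectorGamma W k Ψ‖ = ‖Ψ‖ := by
  refine (denseRange_combi k).induction_on (p := fun Ψ => ‖sectorGamma W k Ψ‖ = ‖Ψ‖) Ψ
    (isClosed_eq (by fun_prop) (by fun_prop)) fun c => ?_
  rw [sectorGamma_combi, norm_combiMap]

/-! ### Vectors of finite particle number -/

variable (μ) in
/-- The dense subspace of the Fock space of vectors of finite particle number. -/
def finiteParticle : Submodule ℂ (Fock μ) where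
  carrier := {Ψ | ∃ K : ℕ, ∀ k, K ≤ k → Ψ k = 0}
  zero_mem' := ⟨0, fun k _ => rfl⟩
  add_mem' := by
    rintro Ψ Φ ⟨K, hK⟩ ⟨L, hL⟩
    refine ⟨max K L, fun k hk => ?_⟩
    rw [lp.coeFn_add, Pi.add_apply, hK k (le_trans (le_max_left _ _) hk),
      hL k (le_trans (le_max_right _ _) hk), add_zero]
  smul_mem' := by
    rintro c Ψ ⟨K, hK⟩
    exact ⟨K, fun k hk => by rw [lp.coeFn_smul, Pi.smul_apply, hK k hk, smul_zero]⟩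

lemma memℓp_of_eventually_zero {Ψ : (k : ℕ) → Sector μ k} {K : ℕ}
    (h : ∀ k, K ≤ k → Ψ k = 0) : Memℓp Ψ 2 := by
  refine Memℓp.of_exponent_ge (memℓp_zero ?_) zero_le
  refine (Set.finite_lt_nat K).subset fun k hk => ?_
  by_contra hlt
  exact hk (h k (not_lt.1 hlt))

/-- The finite particle vector with the given components. -/
def finVec (Ψ : (k : ℕ) → Sector μ k) (h : ∃ K : ℕ, ∀ k, K ≤ k → Ψ k = 0) : finiteParticle μ :=
  ⟨⟨Ψ, memℓp_of_eventually_zero h.choose_spec⟩, h⟩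

lemma finiteParticle_ext {Ψ Φ : finiteParticle μ}
    (h : ∀ k, (Ψ : Fock μ) k = (Φ : Fock μ) k) : Ψ = Φ :=
  Subtype.ext (lp.ext (funext h))

/-- The operator on finite particle vectors acting as `A k` on the `k`-particle sector. -/
def diagOp (A : (k : ℕ) → Sector μ k →ₗ[ℂ] Sector μ k) :
    finiteParticle μ →ₗ[ℂ] finiteParticle μ where
  toFun Ψ := finVec (fun k => A k ((Ψ : Fock μ) k)) (by
    obtain ⟨K, hK⟩ := Ψ.2
    exact ⟨K, fun k hk => by rw [hK k hk, map_zero]⟩)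
  map_add' Ψ Φ := finiteParticle_ext fun k => by
    change A k ((Ψ : Fock μ) k + (Φ : Fock μ) k) = _
    rw [map_add]; rfl
  map_smul' c Ψ := finiteParticle_ext fun k => by
    change A k (c • (Ψ : Fock μ) k) = _
    rw [map_smul]; rfl

/-- The operator on finite particle vectors mapping the `k`-particle sector to the
`(k+1)`-particle sector by `A k`. -/
def raiseOp (A : (k : ℕ) → Sector μ k →ₗ[ℂ] Sector μ (k + 1)) :
    finiteParticle μ →ₗ[ℂ] finiteParticle μ where
  toFun Ψ := finVec
    (fun k => match k with
      | 0 => 0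
      | k + 1 => A k ((Ψ : Fock μ) k)) (by
    obtain ⟨K, hK⟩ := Ψ.2
    refine ⟨K + 1, fun k hk => ?_⟩
    cases k with
    | zero => rfl
    | succ k => simp only [hK k (by omega), map_zero])
  map_add' Ψ Φ := finiteParticle_ext fun k => by
    cases k with
    | zero => exact (add_zero (0 : Sector μ 0)).symm
    | succ k =>
      change A k ((Ψ : Fock μ) k + (Φ : Fock μ) k) = _
      rw [map_add]; rfl
  map_smul' c Ψ := finiteParticle_ext fun k => by
    cases k with
    | zero => exact (smul_zero (A := Sector μ 0) c).symm
    | succ k =>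
      change A k (c • (Ψ : Fock μ) k) = _
      rw [map_smul]; rfl

/-- The operator on finite particle vectors mapping the `(k+1)`-particle sector to the
`k`-particle sector by `A k`, and the vacuum to zero. -/
def lowerOp (A : (k : ℕ) → Sector μ (k + 1) →ₗ[ℂ] Sector μ k) :
    finiteParticle μ →ₗ[ℂ] finiteParticle μ where
  toFun Ψ := finVec (fun k => A k ((Ψ : Fock μ) (k + 1))) (by
    obtain ⟨K, hK⟩ := Ψ.2
    exact ⟨K, fun k hk => by rw [hK (k + 1) (by omega), map_zero]⟩)
  map_add' Ψ Φ := finiteParticle_ext fun k => by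
    change A k ((Ψ : Fock μ) (k + 1) + (Φ : Fock μ) (k + 1)) = _
    rw [map_add]; rfl
  map_smul' c Ψ := finiteParticle_ext fun k => by
    change A k (c • (Ψ : Fock μ) (k + 1)) = _
    rw [map_smul]; rfl

variable (μ) in
/-- The inclusion of the `k`-particle sector. -/
def inclSector (k : ℕ) : Sector μ k →ₗ[ℂ] finiteParticle μ where
  toFun Ψ := ⟨lp.single 2 k Ψ, k + 1, fun j hj =>
    lp.single_apply_ne (E := fun k : ℕ => Sector μ k) 2 k Ψ (by omega)⟩
  map_add' Ψ Φ := Subtype.ext (lp.single_add 2 k Ψ Φ)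
  map_smul' c Ψ := Subtype.ext (lp.single_smul 2 k c Ψ)

/-- The second quantization `Γ(W) = ⨁ₖ W^{⊗ k}`, restricted to finite particle vectors. -/
def secondQuant (W : OneParticle μ ≃ₗᵢ[ℂ] OneParticle μ) :
    finiteParticle μ →ₗ[ℂ] finiteParticle μ :=
  diagOp fun k => (sectorGamma W.toLinearIsometry k : Sector μ k →ₗ[ℂ] Sector μ k)

variable (μ) in
/-- `(N + 1)^{1/2}` on finite particle vectors, `N` being the particle number operator. -/
def sqrtNumberAddOne : finiteParticle μ →ₗ[ℂ] finiteParticle μ :=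
  diagOp fun k => ((Real.sqrt ((k : ℝ) + 1) : ℝ) : ℂ) • LinearMap.id

/-! ### Creation and annihilation operators -/

lemma memLp_cons (h : OneParticle μ) {k : ℕ} (Ψ : WaveFunction μ k) :
    MemLp (fun p : Fin (k + 1) → α => h (p 0) * Ψ (Fin.tail p)) 2 (piMeasure μ (k + 1)) := by
  have hmp := measurePreserving_piFinSuccAbove (fun _ : Fin (k + 1) => μ) 0
  have hprod : MemLp (fun z : α × (Fin k → α) => h z.1 * Ψ z.2) 2 (μ.prod (piMeasure μ k)) := by
    have hm : AEStronglyMeasurable (fun z : α × (Fin k → α) => h z.1 * Ψ z.2)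
        (μ.prod (piMeasure μ k)) :=
      (Lp.aestronglyMeasurable h).comp_fst.mul (Lp.aestronglyMeasurable Ψ).comp_snd
    rw [memLp_two_iff_integrable_sq_norm hm]
    refine (((memLp_two_iff_integrable_sq_norm (Lp.aestronglyMeasurable h)).1
      (Lp.memLp h)).mul_prod ((memLp_two_iff_integrable_sq_norm
        (Lp.aestronglyMeasurable Ψ)).1 (Lp.memLp Ψ))).congr (Eventually.of_forall fun z => ?_)
    simp [mul_pow]
  exact hprod.comp_measurePreserving hmp

/-- The wave function `(h ⊗ Ψ)(p₀, p₁, …, p_k) = h(p₀) Ψ(p₁, …, p_k)`. -/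
def tensorCons (h : OneParticle μ) {k : ℕ} (Ψ : WaveFunction μ k) : WaveFunction μ (k + 1) :=
  (memLp_cons h Ψ).toLp _

lemma norm_tensorCons (h : OneParticle μ) {k : ℕ} (Ψ : WaveFunction μ k) :
    ‖tensorCons h Ψ‖ = ‖h‖ * ‖Ψ‖ := by
  have key : ∀ {β : Type _} [MeasurableSpace β] {ν : Measure β} (f : Lp ℂ 2 ν),
      ‖f‖ ^ 2 = ∫ x, ‖f x‖ ^ 2 ∂ν := by
    intro β _ ν f
    have h1 : ⟪f, f⟫_ℂ = ((∫ x, ‖f x‖ ^ 2 ∂ν : ℝ) : ℂ) := by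
      rw [L2.inner_def, ← integral_complex_ofReal]
      congr 1
      ext x
      rw [inner_self_eq_norm_sq_to_K]
      simp
    have h2 := inner_self_eq_norm_sq_to_K (𝕜 := ℂ) f
    rw [h1] at h2
    exact (Complex.ofReal_injective (by simpa using h2)).symm
  have hmp := measurePreserving_piFinSuccAbove (fun _ : Fin (k + 1) => μ) 0
  have hsq : ‖tensorCons h Ψ‖ ^ 2 = (‖h‖ * ‖Ψ‖) ^ 2 := by
    rw [key, mul_pow, key h, key Ψ]
    have hae : (fun p => ‖tensorCons h Ψ p‖ ^ 2) =ᵐ[piMeasure μ (k + 1)]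
        fun p => ‖h (p 0)‖ ^ 2 * ‖Ψ (Fin.tail p)‖ ^ 2 := by
      filter_upwards [(memLp_cons h Ψ).coeFn_toLp] with p hp
      rw [tensorCons, hp, norm_mul, mul_pow]
    rw [integral_congr_ae hae]
    have := hmp.integral_comp' (fun z : α × (Fin k → α) => ‖h z.1‖ ^ 2 * ‖Ψ z.2‖ ^ 2)
    refine Eq.trans this ?_
    exact integral_prod_mul (fun x => ‖h x‖ ^ 2) (fun y => ‖Ψ y‖ ^ 2)
  exact (pow_left_inj₀ (norm_nonneg _) (by positivity) two_ne_zero).1 hsq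

lemma ae_tail {k : ℕ} {P : (Fin k → α) → Prop} (h : ∀ᵐ p ∂piMeasure μ k, P p) :
    ∀ᵐ p ∂piMeasure μ (k + 1), P (Fin.tail p) := by
  have hmp := measurePreserving_piFinSuccAbove (fun _ : Fin (k + 1) => μ) 0
  have h1 : ∀ᵐ z ∂μ.prod (piMeasure μ k), P z.2 := Measure.quasiMeasurePreserving_snd.ae h
  exact hmp.quasiMeasurePreserving.ae h1

/-- `Ψ ↦ h ⊗ Ψ` as a bounded operator. -/
def tensorConsL (h : OneParticle μ) (k : ℕ) : WaveFunction μ k →L[ℂ] WaveFunction μ (k + 1) :=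
  LinearMap.mkContinuous
    { toFun := tensorCons h
      map_add' := fun Ψ Φ => by
        apply Lp.ext
        filter_upwards [(memLp_cons h (Ψ + Φ)).coeFn_toLp, (memLp_cons h Ψ).coeFn_toLp,
          (memLp_cons h Φ).coeFn_toLp, Lp.coeFn_add (tensorCons h Ψ) (tensorCons h Φ),
          ae_tail (Lp.coeFn_add Ψ Φ)] with p h1 h2 h3 h4 h5
        rw [h4, Pi.add_apply, tensorCons, tensorCons, tensorCons, h1, h2, h3, h5, Pi.add_apply,
          mul_add]
      map_smul' := fun c Ψ => by
        apply Lp.ext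
        filter_upwards [(memLp_cons h (c • Ψ)).coeFn_toLp, (memLp_cons h Ψ).coeFn_toLp,
          Lp.coeFn_smul c (tensorCons h Ψ), ae_tail (Lp.coeFn_smul c Ψ)] with p h1 h2 h4 h5
        rw [RingHom.id_apply, h4, Pi.smul_apply, tensorCons, tensorCons, h1, h2, h5, Pi.smul_apply,
          smul_eq_mul, smul_eq_mul]
        ring }
    ‖h‖ fun Ψ => (norm_tensorCons h Ψ).le

/-- Creation on the `k`-particle sector: `Ψ ↦ √(k+1) P_{k+1} (h ⊗ Ψ)`, where `P_{k+1}` is the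
orthogonal projection onto the bosonic `(k+1)`-particle space. -/
def sectorCreate (h : OneParticle μ) (k : ℕ) : Sector μ k →L[ℂ] Sector μ (k + 1) :=
  ((Real.sqrt ((k : ℝ) + 1) : ℝ) : ℂ) •
    ((symSubspace μ (k + 1)).orthogonalProjectionOnto.comp
      ((tensorConsL h k).comp (symSubspace μ k).subtypeL))

/-- The creation operator `a*(h)` (linear in `h`). -/
def create (h : OneParticle μ) : finiteParticle μ →ₗ[ℂ] finiteParticle μ :=
  raiseOp fun k => (sectorCreate h k : Sector μ k →ₗ[ℂ] Sector μ (k + 1))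

/-- The annihilation operator `a(h)`, adjoint of `a*(h)` (antilinear in `h`). -/
def annihilate (h : OneParticle μ) : finiteParticle μ →ₗ[ℂ] finiteParticle μ :=
  lowerOp fun k => ((sectorCreate h k).adjoint : Sector μ (k + 1) →ₗ[ℂ] Sector μ k)

end Fock

/-! ### The one-particle space of mass `m` in `d = n + 1` space-time dimensions -/

/-- Momentum space `ℝⁿ`. -/
abbrev Mom (n : ℕ) : Type := EuclideanSpace ℝ (Fin n)

/-- Space-time `ℝᵈ`, `d = n + 1`; the coordinate `0` is time. -/
abbrev SpaceTime (n : ℕ) : Type := EuclideanSpace ℝ (Fin (n + 1))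

/-- The Lorentzian scalar product `x₀ y₀ - x₁ y₁ - ⋯ - x_n y_n`. -/
def lorentz {n : ℕ} (x y : SpaceTime n) : ℝ := x 0 * y 0 - ∑ i : Fin n, x i.succ * y i.succ

/-- The energy `ω_p = √(p² + m²)`. -/
def energy {n : ℕ} (m : ℝ) (p : Mom n) : ℝ := Real.sqrt (‖p‖ ^ 2 + m ^ 2)

/-- The point `(ω_p, p)` of the upper mass shell. -/
def onShell {n : ℕ} (m : ℝ) (p : Mom n) : SpaceTime n :=
  WithLp.toLp 2 (Fin.cons (energy m p) fun i => p i)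

/-- The measure `dⁿp / (2 ω_p)`. -/
def shellMeasure (n : ℕ) (m : ℝ) : Measure (Mom n) :=
  (volume : Measure (Mom n)).withDensity fun p => ENNReal.ofReal ((2 * energy m p)⁻¹)

instance (n : ℕ) (m : ℝ) : SigmaFinite (shellMeasure n m) :=
  SigmaFinite.withDensity_ofReal _

/-- The one-particle Hilbert space `L²(ℝⁿ, dⁿp / (2 ω_p))`. -/
abbrev H1 (n : ℕ) (m : ℝ) : Type := OneParticle (shellMeasure n m)

lemma continuous_energy {n : ℕ} (m : ℝ) : Continuous (energy m : Mom n → ℝ) := by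
  unfold energy; fun_prop

lemma continuous_onShell {n : ℕ} (m : ℝ) : Continuous (onShell m : Mom n → SpaceTime n) := by
  refine (PiLp.continuous_toLp 2 _).comp (continuous_pi fun i => ?_)
  refine Fin.cases ?_ (fun j => ?_) i
  · simpa using continuous_energy m
  · simp only [Fin.cons_succ]; fun_prop

lemma continuous_lorentz {n : ℕ} (x : SpaceTime n) : Continuous (lorentz x) := by
  unfold lorentz; fun_prop

lemma memLp_phase {n : ℕ} {m : ℝ} (y : SpaceTime n) (ψ : H1 n m) :
    MemLp (fun p : Mom n => Complex.exp (Complex.I * lorentz y (onShell m p)) * ψ p) 2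
      (shellMeasure n m) := by
  refine (Lp.memLp ψ).of_le ?_ (Eventually.of_forall fun p => ?_)
  · refine Continuous.aestronglyMeasurable ?_ |>.mul (Lp.aestronglyMeasurable ψ)
    have := (continuous_lorentz y).comp (continuous_onShell (n := n) m)
    exact Complex.continuous_exp.comp
      (continuous_const.mul (Complex.continuous_ofReal.comp this))
  · rw [norm_mul, mul_comm Complex.I, Complex.norm_exp_ofReal_mul_I, one_mul]

/-- The action of a translation on one-particle vectors. -/
def translateFun {n : ℕ} {m : ℝ} (y : SpaceTime n) (ψ : H1 n m) : H1 n m :=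
  (memLp_phase y ψ).toLp _

lemma translateFun_neg {n : ℕ} {m : ℝ} (y z : SpaceTime n) (hyz : y + z = 0) (ψ : H1 n m) :
    translateFun y (translateFun z ψ) = ψ := by
  apply Lp.ext
  filter_upwards [(memLp_phase y (translateFun z ψ)).coeFn_toLp,
    (memLp_phase z ψ).coeFn_toLp] with p h1 h2
  rw [translateFun, h1, translateFun, h2, ← mul_assoc, ← Complex.exp_add]
  have : lorentz y (onShell m p) + lorentz z (onShell m p) = 0 := by
    obtain rfl : y = -z := eq_neg_of_add_eq_zero_left hyz
    simp [lorentz]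
  rw [← mul_add, ← Complex.ofReal_add, this]
  simp

/-- The unitary group `e^{i y·P}`, `y·P = y_μ P^μ`, on the one-particle space: multiplication by
`e^{i y·p}` with `p = (ω_p, p)`. -/
def translate1 {n : ℕ} {m : ℝ} (y : SpaceTime n) : H1 n m ≃ₗᵢ[ℂ] H1 n m where
  toFun := translateFun y
  invFun := translateFun (-y)
  left_inv ψ := translateFun_neg _ _ (by simp) ψ
  right_inv ψ := translateFun_neg _ _ (by simp) ψ
  map_add' ψ φ := by
    apply Lp.ext
    filter_upwards [(memLp_phase y (ψ + φ)).coeFn_toLp, (memLp_phase y ψ).coeFn_toLp,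
      (memLp_phase y φ).coeFn_toLp, Lp.coeFn_add (translateFun y ψ) (translateFun y φ),
      Lp.coeFn_add ψ φ] with p h1 h2 h3 h4 h5
    rw [h4, Pi.add_apply, translateFun, translateFun, translateFun, h1, h2, h3, h5, Pi.add_apply,
      mul_add]
  map_smul' c ψ := by
    apply Lp.ext
    filter_upwards [(memLp_phase y (c • ψ)).coeFn_toLp, (memLp_phase y ψ).coeFn_toLp,
      Lp.coeFn_smul c (translateFun y ψ), Lp.coeFn_smul c ψ] with p h1 h2 h4 h5
    rw [RingHom.id_apply, h4, Pi.smul_apply, translateFun, translateFun, h1, h2, h5, Pi.smul_apply,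
      smul_eq_mul, smul_eq_mul]
    ring
  norm_map' ψ := by
    change ‖translateFun y ψ‖ = ‖ψ‖
    rw [Lp.norm_def, Lp.norm_def]
    congr 1
    refine eLpNorm_congr_norm_ae ?_
    filter_upwards [(memLp_phase y ψ).coeFn_toLp] with p h1
    rw [translateFun, h1, norm_mul, mul_comm Complex.I, Complex.norm_exp_ofReal_mul_I, one_mul]

/-! ### Test functions on the mass shell and the free field -/

/-- `p ↦ ∫ dx f(x) e^{i s p·x}` with `p = (ω_p, p)` on the mass shell. -/
def shellFourier {n : ℕ} (m s : ℝ) (f : 𝓢(SpaceTime n, ℂ)) (p : Mom n) : ℂ :=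
  ∫ x : SpaceTime n, f x * Complex.exp (Complex.I * (s * lorentz (onShell m p) x : ℝ))

/-- The Euclidean frequency belonging to `e^{i s p·x}`. -/
def shellFreq {n : ℕ} (m s : ℝ) (p : Mom n) : SpaceTime n :=
  WithLp.toLp 2 (Fin.cons (-(s / (2 * Real.pi)) * energy m p) fun i => s / (2 * Real.pi) * p i)

lemma continuous_shellFreq {n : ℕ} (m s : ℝ) :
    Continuous (shellFreq m s : Mom n → SpaceTime n) := by
  refine (PiLp.continuous_toLp 2 _).comp (continuous_pi fun i => ?_)
  refine Fin.cases ?_ (fun j => ?_) i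
  · exact continuous_const.mul (continuous_energy m)
  · simp only [Fin.cons_succ]; fun_prop

lemma norm_shellFreq {n : ℕ} (m s : ℝ) (hs : |s| = 1) (p : Mom n) :
    ‖p‖ / (2 * Real.pi) ≤ ‖shellFreq m s p‖ := by
  have h : (‖p‖ / (2 * Real.pi)) ^ 2 ≤ ‖shellFreq m s p‖ ^ 2 := by
    rw [EuclideanSpace.norm_sq_eq, Fin.sum_univ_succ, div_pow, EuclideanSpace.norm_sq_eq]
    have hs2 : s ^ 2 = 1 := by rw [← sq_abs, hs, one_pow]
    have : ∑ i : Fin n, ‖shellFreq m s p i.succ‖ ^ 2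
        = (∑ i : Fin n, ‖p i‖ ^ 2) / (2 * Real.pi) ^ 2 := by
      rw [Finset.sum_div]
      refine Finset.sum_congr rfl fun i _ => ?_
      simp only [shellFreq, Fin.cons_succ, Real.norm_eq_abs, sq_abs]
      rw [mul_pow, div_pow, hs2]
      ring
    rw [this]
    exact le_add_of_nonneg_left (sq_nonneg _)
  exact le_of_sq_le_sq h (norm_nonneg _)

lemma shellFourier_eq {n : ℕ} (m s : ℝ) (f : 𝓢(SpaceTime n, ℂ)) (p : Mom n) :
    shellFourier m s f p = (𝓕 f) (shellFreq m s p) := by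
  rw [SchwartzMap.fourier_coe, Real.fourier_eq', shellFourier]
  congr 1
  ext x
  have : s * lorentz (onShell m p) x = -2 * Real.pi * ⟪x, shellFreq m s p⟫_ℝ := by
    have hpi : (Real.pi : ℝ) ≠ 0 := Real.pi_ne_zero
    rw [PiLp.inner_apply, Fin.sum_univ_succ]
    simp only [lorentz, onShell, shellFreq, Fin.cons_zero, Fin.cons_succ, RCLike.inner_apply,
      conj_trivial]
    have : ∑ i : Fin n, s / (2 * Real.pi) * p i * x i.succ
        = s / (2 * Real.pi) * ∑ i : Fin n, p i * x i.succ := by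
      rw [Finset.mul_sum]
      exact Finset.sum_congr rfl fun i _ => by ring
    rw [this]
    field_simp
    ring
  rw [this, smul_eq_mul, mul_comm Complex.I, mul_comm]

lemma shellMeasure_le (n : ℕ) {m : ℝ} (hm : 0 < m) :
    shellMeasure n m ≤ ENNReal.ofReal ((2 * m)⁻¹) • (volume : Measure (Mom n)) := by
  rw [← withDensity_const]
  refine withDensity_mono (Eventually.of_forall fun p => ENNReal.ofReal_le_ofReal ?_)
  have : m ≤ energy m p := Real.le_sqrt_of_sq_le (by nlinarith [sq_nonneg ‖p‖])
  gcongr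

lemma memLp_shellFourier {n : ℕ} {m : ℝ} (hm : 0 < m) {s : ℝ} (hs : |s| = 1)
    (f : 𝓢(SpaceTime n, ℂ)) : MemLp (shellFourier m s f) 2 (shellMeasure n m) := by
  refine MemLp.of_measure_le_smul ENNReal.ofReal_ne_top (shellMeasure_le n hm) ?_
  have hcont : Continuous (shellFourier m s f) := by
    have : shellFourier m s f = fun p => (𝓕 f) (shellFreq m s p) :=
      funext fun p => shellFourier_eq m s f p
    rw [this]
    exact (𝓕 f).continuous.comp (continuous_shellFreq m s)
  obtain ⟨C, hC⟩ : ∃ C : ℝ, ∀ x, (1 + ‖x‖) ^ (n + 1) * ‖(𝓕 f) x‖ ≤ C :=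
    ⟨_, fun x => by
      simpa using SchwartzMap.one_add_le_sup_seminorm_apply (𝕜 := ℂ) (m := (n + 1, 0))
        (k := n + 1) (n := 0) le_rfl le_rfl (𝓕 f) x⟩
  have hpi : (1 : ℝ) ≤ 2 * Real.pi := by nlinarith [Real.pi_gt_three]
  have hbound : ∀ p, ‖shellFourier m s f p‖ ≤
      ‖(C * (2 * Real.pi) ^ (n + 1)) * ((1 + ‖p‖) ^ (n + 1))⁻¹‖ := by
    intro p
    refine le_trans ?_ (le_abs_self _)
    rw [shellFourier_eq, ← div_eq_mul_inv, le_div_iff₀ (by positivity)]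
    have h1 : 1 + ‖p‖ ≤ (1 + ‖shellFreq m s p‖) * (2 * Real.pi) := by
      have := norm_shellFreq m s hs p
      rw [div_le_iff₀ (by positivity)] at this
      linarith
    calc ‖(𝓕 f) (shellFreq m s p)‖ * (1 + ‖p‖) ^ (n + 1)
        ≤ ‖(𝓕 f) (shellFreq m s p)‖ * ((1 + ‖shellFreq m s p‖) * (2 * Real.pi)) ^ (n + 1) := by
          gcongr
      _ = ((1 + ‖shellFreq m s p‖) ^ (n + 1) * ‖(𝓕 f) (shellFreq m s p)‖)
            * (2 * Real.pi) ^ (n + 1) := by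
          rw [mul_pow]; ring
      _ ≤ C * (2 * Real.pi) ^ (n + 1) := by gcongr; exact hC _
  refine MemLp.of_le (f := shellFourier m s f) ?_ hcont.aestronglyMeasurable
    (Eventually.of_forall hbound)
  refine MemLp.const_mul ?_ _
  have hm' : AEStronglyMeasurable (fun p : Mom n => ((1 + ‖p‖) ^ (n + 1))⁻¹) volume := by
    refine Continuous.aestronglyMeasurable (Continuous.inv₀ (by fun_prop) fun p => ?_)
    positivity
  rw [memLp_two_iff_integrable_sq hm']
  have hint := integrable_one_add_norm (E := Mom n) (μ := volume) (r := ((2 * (n + 1) : ℕ) : ℝ))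
    (by rw [finrank_euclideanSpace_fin]; push_cast; linarith)
  refine hint.congr (Eventually.of_forall fun p => ?_)
  simp only
  rw [Real.rpow_neg (by positivity), Real.rpow_natCast, inv_pow, ← pow_mul, mul_comm]

/-- The test function `f⁺(p) = ∫ dx f(x) e^{i p·x}` on the mass shell. -/
def testPlus {n : ℕ} {m : ℝ} (hm : 0 < m) (f : 𝓢(SpaceTime n, ℂ)) : H1 n m :=
  (memLp_shellFourier hm (s := 1) (by simp) f).toLp _

/-- The test function `f⁻(p) = ∫ dx f(x) e^{-i p·x}` on the mass shell. -/
def testMinus {n : ℕ} {m : ℝ} (hm : 0 < m) (f : 𝓢(SpaceTime n, ℂ)) : H1 n m :=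
  (memLp_shellFourier hm (s := -1) (by simp) f).toLp _

/-- The free scalar field `φ(f) = a(conj f⁻) + a*(f⁺)` of mass `m`. -/
def freeField {n : ℕ} {m : ℝ} (hm : 0 < m) (f : 𝓢(SpaceTime n, ℂ)) :
    finiteParticle (shellMeasure n m) →ₗ[ℂ] finiteParticle (shellMeasure n m) :=
  annihilate (star (testMinus hm f)) + create (testPlus hm f)

/-! ### The operator `X`, its domain, and the deformation -/

/-- The dense domain `Δ(P)` of rapidly decreasing one-particle vectors. -/
def DeltaP (n : ℕ) (m : ℝ) : Set (H1 n m) :=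
  {ψ | ∀ r : ℕ, ∃ c : ℝ, ∀ᵐ p ∂shellMeasure n m, ‖((‖p‖ ^ 2) ^ r : ℝ) * ψ p‖ ≤ c}

/-- `Δ_k(P)`, the `k`-fold (symmetric, algebraic) tensor power of `Δ(P)`, in the bosonic
`k`-particle space. -/
def DeltaPk (n : ℕ) (m : ℝ) (k : ℕ) : Submodule ℂ (finiteParticle (shellMeasure n m)) :=
  (Submodule.span ℂ {Ψ | ∃ f : Fin k → H1 n m, (∀ i, f i ∈ DeltaP n m) ∧ symVec f = Ψ}).map
    (inclSector (shellMeasure n m) k)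

/-- `Δ_k(X) = Γ(V⁻¹) Δ_k(P)`. -/
def DeltaXk {n : ℕ} {m : ℝ} (V : H1 n m ≃ₗᵢ[ℂ] H1 n m) (k : ℕ) :
    Submodule ℂ (finiteParticle (shellMeasure n m)) :=
  (DeltaPk n m k).map (secondQuant V.symm)

/-- The algebraic direct sum of the domains `Δ_k(X)`, `k = 0, 1, 2, …`. -/
def DeltaX {n : ℕ} {m : ℝ} (V : H1 n m ≃ₗᵢ[ℂ] H1 n m) :
    Submodule ℂ (finiteParticle (shellMeasure n m)) :=
  ⨆ k : ℕ, DeltaXk V k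

/-- The unitary group `V(y) = e^{i y·X} = Γ(V⁻¹) e^{i y·P} Γ(V)` generated by
`X_μ = Γ(V⁻¹) P_μ Γ(V)`, where `e^{i y·P} = Γ(e^{i y·p})` is the second quantized translation. -/
def groupX {n : ℕ} {m : ℝ} (V : H1 n m ≃ₗᵢ[ℂ] H1 n m) (y : SpaceTime n) :
    finiteParticle (shellMeasure n m) →ₗ[ℂ] finiteParticle (shellMeasure n m) :=
  secondQuant V.symm ∘ₗ secondQuant (translate1 y) ∘ₗ secondQuant V

/-- The adjoint action `β_y(A) = V(y) A V(y)⁻¹`, with `V(y)⁻¹ = V(-y)`. -/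
def adjointX {n : ℕ} {m : ℝ} (V : H1 n m ≃ₗᵢ[ℂ] H1 n m) (y : SpaceTime n)
    (A : finiteParticle (shellMeasure n m) →ₗ[ℂ] finiteParticle (shellMeasure n m)) :
    finiteParticle (shellMeasure n m) →ₗ[ℂ] finiteParticle (shellMeasure n m) :=
  groupX V y ∘ₗ A ∘ₗ groupX V (-y)

/-- Skew-symmetry of a real matrix with respect to the Lorentzian scalar product. -/
def IsLorentzSkew {n : ℕ} (θ : Matrix (Fin (n + 1)) (Fin (n + 1)) ℝ) : Prop :=
  ∀ x y : SpaceTime n,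
    lorentz (Matrix.toEuclideanLin θ x) y = -lorentz x (Matrix.toEuclideanLin θ y)

/-- The regularised integrand `e^{-i x·y} χ(εx, εy) β_{θx}(A) V(y) Φ`. -/
def warpIntegrand {n : ℕ} {m : ℝ} (θ : Matrix (Fin (n + 1)) (Fin (n + 1)) ℝ)
    (V : H1 n m ≃ₗᵢ[ℂ] H1 n m)
    (A : finiteParticle (shellMeasure n m) →ₗ[ℂ] finiteParticle (shellMeasure n m))
    (Φ : finiteParticle (shellMeasure n m)) (χ : 𝓢(SpaceTime n × SpaceTime n, ℂ)) (ε : ℝ)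
    (z : SpaceTime n × SpaceTime n) : Fock (shellMeasure n m) :=
  (Complex.exp (-Complex.I * lorentz z.1 z.2) * χ (ε • z)) •
    (adjointX V (Matrix.toEuclideanLin θ z.1) A (groupX V z.2 Φ) : Fock (shellMeasure n m))

/-- `A_{θ,X} Φ` is well defined as an oscillatory integral and equal to `Ξ`: for every Schwartz
cutoff `χ` with `χ(0,0) = 1` the regularised integrals exist for all `ε ≠ 0` and
`(2π)⁻ᵈ ∬ dx dy e^{-i x·y} χ(εx, εy) β_{θx}(A) V(y) Φ` converges in norm to `Ξ` as `ε → 0`. -/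
def IsWarped {n : ℕ} {m : ℝ} (θ : Matrix (Fin (n + 1)) (Fin (n + 1)) ℝ)
    (V : H1 n m ≃ₗᵢ[ℂ] H1 n m)
    (A : finiteParticle (shellMeasure n m) →ₗ[ℂ] finiteParticle (shellMeasure n m))
    (Φ : finiteParticle (shellMeasure n m)) (Ξ : Fock (shellMeasure n m)) : Prop :=
  ∀ χ : 𝓢(SpaceTime n × SpaceTime n, ℂ), χ (0, 0) = 1 →
    (∀ ε : ℝ, ε ≠ 0 → Integrable (warpIntegrand θ V A Φ χ ε)) ∧
    Tendsto (fun ε : ℝ => ((2 * Real.pi) ^ (n + 1))⁻¹ • ∫ z, warpIntegrand θ V A Φ χ ε z)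
      (𝓝[≠] 0) (𝓝 Ξ)

end DeformedField

end

noncomputable section

namespace DeformedField

/-! ### Partial Fourier transforms of Schwartz functions -/

section Slice

variable {E F : Type*} [NormedAddCommGroup E] [NormedSpace ℝ E] [NormedAddCommGroup F]
  [NormedSpace ℝ F]

/-! After conjugation with `Γ(V)`, only translations act. By covariance `e^{iv·P} a*(g) e^{-iv·P} =
a*(e^{iv·p} g)`, so with `g = V h` and `Ψ = Γ(V)Φ` in the `k`-particle sector the vector under the
integral is `Γ(V⁻¹) √(k+1) P_{k+1}` applied to the fixed wave function `g ⊗ Ψ` times the phase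
`e^{i(θx·p₀ + y·(p₁+⋯+p_k))}`. Skew-symmetry of `θ` turns this phase into `e^{i(x·q + y·Q)}` with `q
= -θp₀` and `Q = p₁+⋯+p_k`. For annihilation the same holds with the contraction against `g` in
place of `g ⊗ ·`, with `q = θp₀` and `Q = p₀+⋯+p_k` (`sectorCreate_translate1`,
`sectorCreate_adjoint_translate1`).

The problem is thereby reduced to the scalar integral of `e^{-ix·y} χ(εx, εy) e^{i(x·q + y·Q)}`. The
volume-preserving substitution `x = Q + εu`, `y = v/ε` cancels the terms singular in `ε` and leaves
the integral over `u` of a unimodular factor times the Fourier transform of `χ` in its second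
variable (`oscIntegral_eq`). That transform decays in `u` uniformly in the first variable, so the
integral is bounded uniformly in `ε ≠ 0`, `q` and `Q` (`exists_norm_oscIntegral_le`). By Fourier
inversion it tends to `(2π)^d χ(0,0) e^{iq·Q}` (`tendsto_oscIntegral`).

Uniform boundedness together with pointwise convergence of the multipliers gives norm convergence in
`L²` (`tendsto_integral_osc`), and bounded operators preserve it (`isWarped_of_osc`). Warping thus
only inserts the unimodular multiplier `e^{iq·Q}`. Multiplication by it is isometric, so the free
number bounds survive unchanged. Neither the limit nor the bounds need decay of the wave functions,
so the operators exist on all finite particle vectors and are restricted to `Δ(X)` at the end. -/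

lemma norm_iteratedFDeriv_slice_le (χ : 𝓢(E × F, ℂ)) (x : E) (k l : ℕ) (y : F) :
    ‖y‖ ^ k * ‖iteratedFDeriv ℝ l (fun y => χ (x, y)) y‖ ≤ SchwartzMap.seminorm ℝ k l χ := by
  -- A slice is a translate of `χ` composed with the inclusion of the second factor, which has norm
  -- at most one. Since also `‖y‖ ≤ ‖(x, y)‖`, no dependence on `x` enters the bound.
  have hfun : (fun y : F => χ (x, y))
      = (fun z : E × F => χ ((x, 0) + z)) ∘ ContinuousLinearMap.inr ℝ E F := by
    ext y; simp
  have hs : ContDiff ℝ l fun z : E × F => χ ((x, 0) + z) :=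
    (χ.smooth l).comp (contDiff_const.add contDiff_id)
  rw [hfun, (ContinuousLinearMap.inr ℝ E F).iteratedFDeriv_comp_right hs y le_rfl,
    iteratedFDeriv_comp_add_left]
  have hxy : ((x, 0) : E × F) + ContinuousLinearMap.inr ℝ E F y = (x, y) := by simp
  rw [hxy]
  have h1 := (iteratedFDeriv ℝ l χ (x, y)).norm_compContinuousLinearMap_le
    fun _ => ContinuousLinearMap.inr ℝ E F
  have h2 : ∏ _i : Fin l, ‖ContinuousLinearMap.inr ℝ E F‖ ≤ 1 :=
    Finset.prod_le_one (fun _ _ => norm_nonneg _)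
      fun _ _ => ContinuousLinearMap.norm_inr_le_one ℝ E F
  refine le_trans ?_ (χ.le_seminorm ℝ k l (x, y))
  gcongr
  · exact norm_snd_le (x, y)
  · exact h1.trans (mul_le_of_le_one_right (norm_nonneg _) h2)

/-- The Schwartz function `y ↦ χ (x, y)`. -/
def slice (χ : 𝓢(E × F, ℂ)) (x : E) : 𝓢(F, ℂ) where
  toFun y := χ (x, y)
  smooth' := (χ.smooth ⊤).comp (contDiff_const.prodMk contDiff_id)
  decay' k l := ⟨_, norm_iteratedFDeriv_slice_le χ x k l⟩

@[simp] lemma slice_apply (χ : 𝓢(E × F, ℂ)) (x : E) (y : F) : slice χ x y = χ (x, y) := rfl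

lemma seminorm_slice_le (χ : 𝓢(E × F, ℂ)) (x : E) (k l : ℕ) :
    SchwartzMap.seminorm ℝ k l (slice χ x) ≤ SchwartzMap.seminorm ℝ k l χ :=
  (slice χ x).seminorm_le_bound ℝ k l (apply_nonneg _ _) (norm_iteratedFDeriv_slice_le χ x k l)

lemma exists_one_add_pow_mul_slice_le (χ : 𝓢(E × F, ℂ)) (N : ℕ) :
    ∃ C : ℝ, ∀ x y, (1 + ‖y‖) ^ N * ‖χ (x, y)‖ ≤ C := by
  obtain ⟨C, hC⟩ : ∃ C : ℝ, ∀ z, (1 + ‖z‖) ^ N * ‖χ z‖ ≤ C :=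
    ⟨_, fun x => by
      simpa using SchwartzMap.one_add_le_sup_seminorm_apply (𝕜 := ℝ) (m := (N, 0))
        (k := N) (n := 0) le_rfl le_rfl χ x⟩
  refine ⟨C, fun x y => le_trans ?_ (hC (x, y))⟩
  gcongr
  exact norm_snd_le (x, y)

end Slice

section SliceFourier

variable {E F : Type*} [NormedAddCommGroup E] [NormedSpace ℝ E] [NormedAddCommGroup F]
  [InnerProductSpace ℝ F] [FiniteDimensional ℝ F] [MeasurableSpace F] [BorelSpace F]

/-- The slices form a bounded family in Schwartz space, and the Fourier transform is continuous
there. Each seminorm of the transform is controlled by finitely many seminorms of the slice, hence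
of `χ`, which makes the constant independent of `x`. -/
lemma exists_one_add_pow_mul_fourier_slice_le (χ : 𝓢(E × F, ℂ)) (N : ℕ) :
    ∃ C : ℝ, ∀ x ξ, (1 + ‖ξ‖) ^ N * ‖𝓕 (slice χ x) ξ‖ ≤ C := by
  set p : Seminorm ℝ 𝓢(F, ℂ) := (Finset.Iic (N, 0)).sup fun m => SchwartzMap.seminorm ℝ m.1 m.2
  have hp : Continuous p :=
    (schwartz_withSeminorms ℝ F ℂ).finset_sups.continuous_seminorm (Finset.Iic (N, 0))
  obtain ⟨s, C, -, hC⟩ := Seminorm.bound_of_continuous (schwartz_withSeminorms ℝ F ℂ)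
    (p.comp (FourierTransform.fourierCLM ℝ 𝓢(F, ℂ)).toLinearMap)
    (hp.comp (FourierTransform.fourierCLM ℝ 𝓢(F, ℂ)).continuous)
  refine ⟨2 ^ N * (C * (s.sup (schwartzSeminormFamily ℝ (E × F) ℂ)) χ), fun x ξ => ?_⟩
  have h1 := SchwartzMap.one_add_le_sup_seminorm_apply (𝕜 := ℝ) (m := (N, 0))
        (k := N) (n := 0) le_rfl le_rfl (𝓕 (slice χ x)) ξ
  rw [norm_iteratedFDeriv_zero] at h1
  refine h1.trans ?_
  gcongr
  refine (hC (slice χ x)).trans ?_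
  rw [smul_apply, NNReal.smul_def, smul_eq_mul]
  gcongr
  refine Seminorm.finset_sup_apply_le (apply_nonneg _ _) fun i hi => ?_
  exact (seminorm_slice_le χ x i.1 i.2).trans
    (Seminorm.le_finset_sup_apply (p := schwartzSeminormFamily ℝ (E × F) ℂ) hi)

end SliceFourier

lemma integrable_inv_one_add_norm_pow {F : Type*} [NormedAddCommGroup F] [NormedSpace ℝ F]
    [FiniteDimensional ℝ F] [MeasurableSpace F] [BorelSpace F] (μ : Measure F)
    [μ.IsAddHaarMeasure] : Integrable (fun x : F => ((1 + ‖x‖) ^ (Module.finrank ℝ F + 1))⁻¹) μ := by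
  have := integrable_one_add_norm (E := F) (μ := μ) (r := ((Module.finrank ℝ F + 1 : ℕ) : ℝ))
    (by push_cast; linarith)
  refine this.congr (Eventually.of_forall fun p => ?_)
  simp only
  rw [Real.rpow_neg (by positivity), Real.rpow_natCast]

/-! ### The scalar oscillatory integral -/

/-- The reflection of the spatial coordinates. -/
def spaceReflect (n : ℕ) : SpaceTime n ≃ₗᵢ[ℝ] SpaceTime n :=
  LinearIsometryEquiv.piLpCongrRight 2 fun i : Fin (n + 1) =>
    if i = 0 then LinearIsometryEquiv.refl ℝ ℝ else LinearIsometryEquiv.neg ℝ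

/-- This is the bridge to Euclidean Fourier analysis: the reflection is a linear isometry, so it
changes neither norms nor volume. -/
lemma lorentz_eq_inner {n : ℕ} (x y : SpaceTime n) : lorentz x y = ⟪spaceReflect n x, y⟫_ℝ := by
  rw [PiLp.inner_apply, Fin.sum_univ_succ, lorentz]
  simp [spaceReflect, LinearIsometryEquiv.piLpCongrRight_apply, Fin.succ_ne_zero, mul_comm,
    Finset.sum_neg_distrib, sub_eq_add_neg]

lemma lorentz_add_left {n : ℕ} (x y z : SpaceTime n) :
    lorentz (x + y) z = lorentz x z + lorentz y z := by
  simp [lorentz_eq_inner, inner_add_left]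

lemma lorentz_smul_left {n : ℕ} (c : ℝ) (x z : SpaceTime n) :
    lorentz (c • x) z = c * lorentz x z := by
  simp [lorentz_eq_inner, inner_smul_left]

lemma lorentz_smul_right {n : ℕ} (c : ℝ) (x z : SpaceTime n) :
    lorentz x (c • z) = c * lorentz x z := by
  simp [lorentz_eq_inner, inner_smul_right]

lemma lorentz_comm {n : ℕ} (x y : SpaceTime n) : lorentz x y = lorentz y x := by
  simp [lorentz, mul_comm]

lemma continuous_lorentz_uncurry {n : ℕ} :
    Continuous fun z : SpaceTime n × SpaceTime n => lorentz z.1 z.2 := by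
  unfold lorentz; fun_prop

/-- The regularised oscillating weight `e^{-i x·y} χ(εx, εy)`. -/
def oscWeight {n : ℕ} (χ : 𝓢(SpaceTime n × SpaceTime n, ℂ)) (ε : ℝ)
    (z : SpaceTime n × SpaceTime n) : ℂ :=
  Complex.exp (-Complex.I * lorentz z.1 z.2) * χ (ε • z)

/-- The regularised integral `∬ e^{-i x·y} χ(εx, εy) e^{i (x·q + y·Q)} dx dy`. -/
def oscIntegral {n : ℕ} (χ : 𝓢(SpaceTime n × SpaceTime n, ℂ)) (ε : ℝ) (q Q : SpaceTime n) : ℂ :=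
  ∫ z : SpaceTime n × SpaceTime n,
    oscWeight χ ε z * Complex.exp ((lorentz z.1 q + lorentz z.2 Q : ℝ) * Complex.I)

lemma continuous_oscWeight {n : ℕ} (χ : 𝓢(SpaceTime n × SpaceTime n, ℂ)) (ε : ℝ) :
    Continuous (oscWeight χ ε) := by
  have := continuous_lorentz_uncurry (n := n)
  have := χ.continuous
  unfold oscWeight
  fun_prop

lemma norm_oscWeight {n : ℕ} (χ : 𝓢(SpaceTime n × SpaceTime n, ℂ)) (ε : ℝ)
    (z : SpaceTime n × SpaceTime n) : ‖oscWeight χ ε z‖ = ‖χ (ε • z)‖ := by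
  have : -Complex.I * lorentz z.1 z.2 = ((-lorentz z.1 z.2 : ℝ) : ℂ) * Complex.I := by
    push_cast; ring
  rw [oscWeight, norm_mul, this, Complex.norm_exp_ofReal_mul_I, one_mul]

instance (n : ℕ) : (volume : Measure (SpaceTime n × SpaceTime n)).IsAddHaarMeasure :=
  Measure.prod.instIsAddHaarMeasure _ _

lemma integrable_oscWeight {n : ℕ} (χ : 𝓢(SpaceTime n × SpaceTime n, ℂ)) {ε : ℝ} (hε : ε ≠ 0) :
    Integrable (oscWeight χ ε) := by
  have h : Integrable fun z : SpaceTime n × SpaceTime n => χ (ε • z) :=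
    (χ.integrable (μ := volume)).comp_smul hε
  exact h.congr' (continuous_oscWeight χ ε).aestronglyMeasurable
    (Eventually.of_forall fun z => (norm_oscWeight χ ε z).symm)

lemma integrable_oscWeight_mul_exp {n : ℕ} (χ : 𝓢(SpaceTime n × SpaceTime n, ℂ)) {ε : ℝ}
    (hε : ε ≠ 0) (q Q : SpaceTime n) :
    Integrable fun z : SpaceTime n × SpaceTime n =>
      oscWeight χ ε z * Complex.exp ((lorentz z.1 q + lorentz z.2 Q : ℝ) * Complex.I) := by
  have hc : Continuous fun z : SpaceTime n × SpaceTime n =>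
      oscWeight χ ε z * Complex.exp ((lorentz z.1 q + lorentz z.2 Q : ℝ) * Complex.I) := by
    have := continuous_oscWeight χ ε
    unfold lorentz
    fun_prop
  refine (integrable_oscWeight χ hε).congr' hc.aestronglyMeasurable
    (Eventually.of_forall fun z => ?_)
  rw [norm_mul, Complex.norm_exp_ofReal_mul_I, mul_one]

/-- The Jacobians `|ε|^d` and `|ε|^{-d}` of the two substitutions cancel. Each step is an
unconditional change of variables, so no integrability is required. -/
lemma integral_integral_affine {E : Type*} [NormedAddCommGroup E] [NormedSpace ℝ E]
    [FiniteDimensional ℝ E] [MeasurableSpace E] [BorelSpace E] (μ : Measure E)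
    [μ.IsAddHaarMeasure] (f : E → E → ℂ) (a : E) {ε : ℝ} (hε : ε ≠ 0) :
    ∫ x, ∫ y, f x y ∂μ ∂μ = ∫ u, ∫ v, f (a + ε • u) (ε⁻¹ • v) ∂μ ∂μ := by
  have h1 : ∀ u : E, ∫ v, f (a + ε • u) (ε⁻¹ • v) ∂μ
      = |ε ^ Module.finrank ℝ E| • ∫ y, f (a + ε • u) y ∂μ := fun u =>
    μ.integral_comp_inv_smul (f (a + ε • u)) ε
  simp_rw [h1]
  rw [integral_smul, μ.integral_comp_smul (fun x => ∫ y, f (a + x) y ∂μ) ε,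
    integral_add_left_eq_self (fun x => ∫ y, f x y ∂μ) a, smul_smul, abs_inv,
    mul_inv_cancel₀ (by positivity), one_smul]

/-- Centring `x` at the stationary point `Q` makes the terms `∓ε⁻¹ Q·v` cancel. What remains of the
`v`-dependent phase is `e^{-iu·v}`, so the `v`-integral is a Fourier transform of a slice of `χ`. -/
lemma oscIntegral_eq {n : ℕ} (χ : 𝓢(SpaceTime n × SpaceTime n, ℂ)) {ε : ℝ} (hε : ε ≠ 0)
    (q Q : SpaceTime n) :
    oscIntegral χ ε q Q = ∫ u : SpaceTime n,
      Complex.exp ((lorentz (Q + ε • u) q : ℝ) * Complex.I) *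
        𝓕 (slice χ (ε • (Q + ε • u))) ((2 * Real.pi)⁻¹ • spaceReflect n u) := by
  have hint := integrable_oscWeight_mul_exp χ hε q Q
  rw [oscIntegral, Measure.volume_eq_prod, integral_prod _ hint,
    integral_integral_affine volume
      (fun x y => oscWeight χ ε (x, y) *
        Complex.exp ((lorentz x q + lorentz y Q : ℝ) * Complex.I)) Q hε]
  congr 1
  ext u
  rw [SchwartzMap.fourier_coe, Real.fourier_eq', ← integral_const_mul]
  congr 1
  ext v
  -- The factor `(2π)⁻¹` compensates the `e^{-2πi⟨·,·⟩}` normalisation of `𝓕`.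
  have h1 : ⟪v, (2 * Real.pi)⁻¹ • spaceReflect n u⟫_ℝ = (2 * Real.pi)⁻¹ * lorentz u v := by
    rw [inner_smul_right, real_inner_comm, lorentz_eq_inner]
  have h2 : ε • ((Q + ε • u, ε⁻¹ • v) : SpaceTime n × SpaceTime n) = (ε • (Q + ε • u), v) := by
    rw [Prod.smul_mk, smul_inv_smul₀ hε]
  simp only [oscWeight, h1, h2, slice_apply, smul_eq_mul]
  rw [mul_right_comm, ← Complex.exp_add, ← mul_assoc, ← Complex.exp_add]
  congr 2
  have h3 : lorentz (Q + ε • u) (ε⁻¹ • v) = ε⁻¹ * lorentz v Q + lorentz u v := by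
    rw [lorentz_smul_right, lorentz_add_left, lorentz_smul_left, mul_add, inv_mul_cancel_left₀ hε,
      lorentz_comm Q v]
  have h4 : -2 * Real.pi * ((2 * Real.pi)⁻¹ * lorentz u v) = -lorentz u v := by
    field_simp
  rw [h3, h4, lorentz_smul_left]
  push_cast
  ring

/-- A bound on the partial Fourier transform of a Schwartz function, in the form needed for
dominated convergence. -/
lemma exists_integrable_bound_fourier_slice {n : ℕ} (χ : 𝓢(SpaceTime n × SpaceTime n, ℂ)) :
    ∃ b : SpaceTime n → ℝ, Integrable b ∧ ∀ x u,
      ‖𝓕 (slice χ x) ((2 * Real.pi)⁻¹ • spaceReflect n u)‖ ≤ b u := by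
  obtain ⟨C, hC⟩ := exists_one_add_pow_mul_fourier_slice_le χ (Module.finrank ℝ (SpaceTime n) + 1)
  have h0 := (integrable_inv_one_add_norm_pow (volume : Measure (SpaceTime n))).const_mul C
  refine ⟨fun u => C * ((1 + ‖(2 * Real.pi)⁻¹ • u‖) ^ (Module.finrank ℝ (SpaceTime n) + 1))⁻¹,
    h0.comp_smul (R := (2 * Real.pi)⁻¹) (by positivity), fun x u => ?_⟩
  simp only
  rw [← div_eq_mul_inv, le_div_iff₀ (by positivity), mul_comm]
  have := hC x ((2 * Real.pi)⁻¹ • spaceReflect n u)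
  rwa [norm_smul, LinearIsometryEquiv.norm_map, ← norm_smul] at this

/-- The estimate `∫ |χ(εz)| dz` on the original integral blows up as `ε → 0`. After the substitution
the integrand has a majorant free of `ε`, `q` and `Q`. -/
lemma exists_norm_oscIntegral_le {n : ℕ} (χ : 𝓢(SpaceTime n × SpaceTime n, ℂ)) :
    ∃ C : ℝ, ∀ ε : ℝ, ε ≠ 0 → ∀ q Q, ‖oscIntegral χ ε q Q‖ ≤ C := by
  obtain ⟨b, hb, h⟩ := exists_integrable_bound_fourier_slice χ
  refine ⟨∫ u, b u, fun ε hε q Q => ?_⟩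
  rw [oscIntegral_eq χ hε]
  refine norm_integral_le_of_norm_le hb (Eventually.of_forall fun u => ?_)
  rw [norm_mul, Complex.norm_exp_ofReal_mul_I, one_mul]
  exact h _ u

/-- Dominated convergence applies because `χ (x, y)` decays in `y` uniformly in `x`. -/
lemma continuous_fourier_slice {n : ℕ} (χ : 𝓢(SpaceTime n × SpaceTime n, ℂ)) :
    Continuous fun z : SpaceTime n × SpaceTime n => 𝓕 (slice χ z.1) z.2 := by
  obtain ⟨C, hC⟩ := exists_one_add_pow_mul_slice_le χ (Module.finrank ℝ (SpaceTime n) + 1)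
  have h0 := (integrable_inv_one_add_norm_pow (volume : Measure (SpaceTime n))).const_mul C
  simp_rw [SchwartzMap.fourier_coe, Real.fourier_eq', slice_apply]
  refine continuous_of_dominated (fun z => ?_) (fun z => Eventually.of_forall fun y => ?_) h0
    (Eventually.of_forall fun y => ?_)
  · have := χ.continuous
    exact Continuous.aestronglyMeasurable (by fun_prop)
  · rw [norm_smul, Complex.norm_exp_ofReal_mul_I, one_mul, ← div_eq_mul_inv,
      le_div_iff₀ (by positivity), mul_comm]
    exact hC z.1 y
  · have := χ.continuous
    fun_prop

/-- Fourier inversion at the origin: the reflection preserves volume and the dilation by `2π`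
contributes the power. -/
lemma integral_fourier_spaceReflect {n : ℕ} (g : 𝓢(SpaceTime n, ℂ)) :
    ∫ u, 𝓕 g ((2 * Real.pi)⁻¹ • spaceReflect n u) = ((2 * Real.pi) ^ (n + 1) : ℝ) * g 0 := by
  have h1 := (spaceReflect n).measurePreserving.integral_comp
    (spaceReflect n).toHomeomorph.measurableEmbedding fun u => 𝓕 g ((2 * Real.pi)⁻¹ • u)
  rw [h1, Measure.integral_comp_inv_smul, finrank_euclideanSpace_fin, abs_of_pos (by positivity)]
  have h2 : 𝓕⁻ (𝓕 g) 0 = g 0 := by rw [FourierTransform.fourierInv_fourier_eq]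
  rw [SchwartzMap.fourierInv_coe, Real.fourierInv_eq'] at h2
  simp only [inner_zero_right, mul_zero, Complex.ofReal_zero, zero_mul, Complex.exp_zero,
    one_smul] at h2
  rw [h2, Complex.real_smul]

lemma tendsto_oscIntegral {n : ℕ} (χ : 𝓢(SpaceTime n × SpaceTime n, ℂ)) (q Q : SpaceTime n) :
    Tendsto (fun ε : ℝ => oscIntegral χ ε q Q) (𝓝[≠] 0)
      (𝓝 (((2 * Real.pi) ^ (n + 1) : ℝ) * χ (0, 0) *
        Complex.exp ((lorentz Q q : ℝ) * Complex.I))) := by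
  obtain ⟨b, hb, h⟩ := exists_integrable_bound_fourier_slice χ
  have hc := continuous_fourier_slice χ
  have hl := continuous_lorentz_uncurry (n := n)
  have hlim : Tendsto (fun ε : ℝ => ∫ u : SpaceTime n,
      Complex.exp ((lorentz (Q + ε • u) q : ℝ) * Complex.I) *
        𝓕 (slice χ (ε • (Q + ε • u))) ((2 * Real.pi)⁻¹ • spaceReflect n u)) (𝓝[≠] 0)
      (𝓝 (∫ u : SpaceTime n, Complex.exp ((lorentz Q q : ℝ) * Complex.I) *
        𝓕 (slice χ 0) ((2 * Real.pi)⁻¹ • spaceReflect n u))) := by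
    -- Joint continuity in `(ε, u)` serves twice: for measurability in `u` at fixed `ε`, and for the
    -- pointwise limit `ε → 0` at fixed `u`.
    have hcont : Continuous fun w : ℝ × SpaceTime n =>
        Complex.exp ((lorentz (Q + w.1 • w.2) q : ℝ) * Complex.I) *
        𝓕 (slice χ (w.1 • (Q + w.1 • w.2))) ((2 * Real.pi)⁻¹ • spaceReflect n w.2) := by
      have h1 : Continuous fun w : ℝ × SpaceTime n => lorentz (Q + w.1 • w.2) q :=
        hl.comp (f := fun w : ℝ × SpaceTime n => (Q + w.1 • w.2, q)) (by fun_prop)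
      have h2 : Continuous fun w : ℝ × SpaceTime n =>
          𝓕 (slice χ (w.1 • (Q + w.1 • w.2))) ((2 * Real.pi)⁻¹ • spaceReflect n w.2) :=
        hc.comp (f := fun w : ℝ × SpaceTime n =>
          (w.1 • (Q + w.1 • w.2), (2 * Real.pi)⁻¹ • spaceReflect n w.2)) (by fun_prop)
      fun_prop
    refine tendsto_integral_filter_of_dominated_convergence b (Eventually.of_forall fun ε => ?_)
      (Eventually.of_forall fun ε => Eventually.of_forall fun u => ?_) hb
      (Eventually.of_forall fun u => ?_)
    · exact (hcont.comp (Continuous.prodMk_right ε)).aestronglyMeasurable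
    · rw [norm_mul, Complex.norm_exp_ofReal_mul_I, one_mul]
      exact h _ u
    · have := (hcont.comp (Continuous.prodMk_left u)).tendsto 0
      simp only [Function.comp_def, zero_smul, add_zero] at this
      exact this.mono_left nhdsWithin_le_nhds
  rw [integral_const_mul, integral_fourier_spaceReflect, slice_apply, mul_comm (Complex.exp _)] at hlim
  refine hlim.congr' ?_
  filter_upwards [self_mem_nhdsWithin] with ε hε
  rw [oscIntegral_eq χ hε]

/-! ### Multiplication by phases on `L²` -/

section Phase

variable {β : Type*} [MeasurableSpace β] {ν : Measure β}

lemma norm_sq_eq_integral (f : Lp ℂ 2 ν) : ‖f‖ ^ 2 = ∫ x, ‖f x‖ ^ 2 ∂ν := by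
  have h1 : ⟪f, f⟫_ℂ = ((∫ x, ‖f x‖ ^ 2 ∂ν : ℝ) : ℂ) := by
    rw [L2.inner_def, ← integral_complex_ofReal]
    congr 1
    ext x
    rw [inner_self_eq_norm_sq_to_K]
    simp
  have h2 := inner_self_eq_norm_sq_to_K (𝕜 := ℂ) f
  rw [h1] at h2
  exact (Complex.ofReal_injective (by simpa using h2)).symm

lemma norm_star_Lp (f : Lp ℂ 2 ν) : ‖star f‖ = ‖f‖ := by
  rw [Lp.norm_def, Lp.norm_def]
  congr 1
  refine eLpNorm_congr_norm_ae ?_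
  filter_upwards [Lp.coeFn_star f] with p h
  rw [h, Pi.star_apply, norm_star]

/-- Dominated convergence in `L²` for bounded multipliers of a fixed vector. -/
lemma tendsto_of_ae_eq_mul {ι : Type*} {l : Filter ι} [l.IsCountablyGenerated]
    {X : ι → Lp ℂ 2 ν} {X₀ Ω : Lp ℂ 2 ν} {φ : ι → β → ℂ} {φ₀ : β → ℂ} (C : ℝ)
    (hX : ∀ᶠ i in l, X i =ᵐ[ν] fun b => φ i b * Ω b) (hX₀ : X₀ =ᵐ[ν] fun b => φ₀ b * Ω b)
    (hC : ∀ᶠ i in l, ∀ b, ‖φ i b - φ₀ b‖ ≤ C)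
    (hlim : ∀ b, Tendsto (fun i => φ i b) l (𝓝 (φ₀ b))) : Tendsto X l (𝓝 X₀) := by
  rw [tendsto_iff_norm_sub_tendsto_zero]
  -- The squared norm is an ordinary integral, to which dominated convergence applies with majorant
  -- `C² |Ω|²`.
  have hsq : Tendsto (fun i => ‖X i - X₀‖ ^ 2) l (𝓝 0) := by
    simp_rw [norm_sq_eq_integral]
    have hΩ : Integrable (fun b => C ^ 2 * ‖Ω b‖ ^ 2) ν :=
      ((memLp_two_iff_integrable_sq_norm (Lp.aestronglyMeasurable Ω)).1 (Lp.memLp Ω)).const_mul _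
    have hae : ∀ᶠ i in l, ∀ᵐ b ∂ν, (X i - X₀ : Lp ℂ 2 ν) b = (φ i b - φ₀ b) * Ω b := by
      filter_upwards [hX] with i hi
      filter_upwards [Lp.coeFn_sub (X i) X₀, hi, hX₀] with b h1 h2 h3
      rw [h1, Pi.sub_apply, h2, h3, sub_mul]
    have hlim' : Tendsto (fun i => ∫ b, ‖(φ i b - φ₀ b) * Ω b‖ ^ 2 ∂ν) l (𝓝 (∫ _b, (0 : ℝ) ∂ν)) := by
      refine tendsto_integral_filter_of_dominated_convergence _ ?_ ?_ hΩ
        (Eventually.of_forall fun b => ?_)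
      · filter_upwards [hae] with i hi
        refine AEStronglyMeasurable.congr
          ((Lp.aestronglyMeasurable (X i - X₀)).norm.pow 2) ?_
        filter_upwards [hi] with b hb
        simp only [Pi.pow_apply, hb]
      · filter_upwards [hC] with i hi
        refine Eventually.of_forall fun b => ?_
        rw [norm_mul, mul_pow, norm_mul, norm_pow, norm_pow, norm_norm, norm_norm]
        gcongr
        exact hi b
      · have h1 : Tendsto (fun i => φ i b - φ₀ b) l (𝓝 0) := by
          simpa using (hlim b).sub_const (φ₀ b)
        have h2 := ((h1.mul_const (Ω b)).norm).pow 2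
        simpa using h2
    rw [integral_zero] at hlim'
    refine hlim'.congr' ?_
    filter_upwards [hae] with i hi
    refine integral_congr_ae ?_
    filter_upwards [hi] with b hb
    rw [hb]
  have := hsq.sqrt
  simpa [Real.sqrt_sq (norm_nonneg _)] using this

lemma memLp_phaseMul {s : β → ℝ} (hs : Measurable s) (ψ : Lp ℂ 2 ν) :
    MemLp (fun b => Complex.exp (s b * Complex.I) * ψ b) 2 ν := by
  refine (Lp.memLp ψ).of_le ?_ (Eventually.of_forall fun p => ?_)
  · exact (Measurable.aestronglyMeasurable (by fun_prop)).mul (Lp.aestronglyMeasurable ψ)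
  · rw [norm_mul, Complex.norm_exp_ofReal_mul_I, one_mul]

/-- Multiplication by the phase `e^{i s}` on `L²`. -/
def phaseMul {s : β → ℝ} (hs : Measurable s) : Lp ℂ 2 ν →ₗᵢ[ℂ] Lp ℂ 2 ν where
  toFun ψ := (memLp_phaseMul hs ψ).toLp _
  map_add' ψ φ := by
    apply Lp.ext
    filter_upwards [(memLp_phaseMul hs (ψ + φ)).coeFn_toLp, (memLp_phaseMul hs ψ).coeFn_toLp,
      (memLp_phaseMul hs φ).coeFn_toLp,
      Lp.coeFn_add ((memLp_phaseMul hs ψ).toLp _) ((memLp_phaseMul hs φ).toLp _),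
      Lp.coeFn_add ψ φ] with p h1 h2 h3 h4 h5
    rw [h4, Pi.add_apply, h1, h2, h3, h5, Pi.add_apply, mul_add]
  map_smul' c ψ := by
    apply Lp.ext
    filter_upwards [(memLp_phaseMul hs (c • ψ)).coeFn_toLp, (memLp_phaseMul hs ψ).coeFn_toLp,
      Lp.coeFn_smul c ((memLp_phaseMul hs ψ).toLp _), Lp.coeFn_smul c ψ] with p h1 h2 h4 h5
    rw [RingHom.id_apply, h4, Pi.smul_apply, h1, h2, h5, Pi.smul_apply, smul_eq_mul, smul_eq_mul]
    ring
  norm_map' ψ := by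
    change ‖(memLp_phaseMul hs ψ).toLp _‖ = ‖ψ‖
    rw [Lp.norm_def, Lp.norm_def]
    congr 1
    refine eLpNorm_congr_norm_ae ?_
    filter_upwards [(memLp_phaseMul hs ψ).coeFn_toLp] with p h1
    rw [h1, norm_mul, Complex.norm_exp_ofReal_mul_I, one_mul]

lemma coeFn_phaseMul {s : β → ℝ} (hs : Measurable s) (ψ : Lp ℂ 2 ν) :
    phaseMul hs ψ =ᵐ[ν] fun b => Complex.exp (s b * Complex.I) * ψ b :=
  (memLp_phaseMul hs ψ).coeFn_toLp

/-- The total phase is a separate function `u` tied to `s` and `t` only pointwise, so that algebraic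
rewritings of a phase need not touch the measurability proof carried by `phaseMul`. -/
lemma phaseMul_phaseMul {s t u : β → ℝ} (hs : Measurable s) (ht : Measurable t)
    (hu : Measurable u) (h : ∀ b, s b + t b = u b) (ψ : Lp ℂ 2 ν) :
    phaseMul hs (phaseMul ht ψ) = phaseMul hu ψ := by
  apply Lp.ext
  filter_upwards [coeFn_phaseMul hs (phaseMul ht ψ), coeFn_phaseMul ht ψ,
    coeFn_phaseMul hu ψ] with b h1 h2 h3
  rw [h1, h2, h3, ← mul_assoc, ← Complex.exp_add, ← h b]
  push_cast
  ring_nf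

/-- Opposite phases are mutually inverse isometries, hence mutually adjoint. -/
lemma inner_phaseMul_left {s t : β → ℝ} (hs : Measurable s) (ht : Measurable t)
    (h : ∀ b, s b + t b = 0) (ψ φ : Lp ℂ 2 ν) :
    ⟪phaseMul hs ψ, φ⟫_ℂ = ⟪ψ, phaseMul ht φ⟫_ℂ := by
  have h1 : φ = phaseMul hs (phaseMul ht φ) := by
    rw [phaseMul_phaseMul hs ht (u := fun _ => 0) measurable_const h]
    apply Lp.ext
    filter_upwards [coeFn_phaseMul (measurable_const (a := (0 : ℝ))) φ] with b hb
    rw [hb]; simp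
  conv_lhs => rw [h1]
  rw [LinearIsometry.inner_map_map]

end Phase

/-! ### The oscillatory integral of phase multiplications -/

section OscPhase

variable {n : ℕ} {β : Type*} [MeasurableSpace β] {ν : Measure β} {q Q : β → SpaceTime n}

lemma measurable_lorentz_comp (hq : Measurable q) (x : SpaceTime n) :
    Measurable fun b => lorentz x (q b) :=
  (continuous_lorentz x).measurable.comp hq

lemma measurable_oscPhase (hq : Measurable q) (hQ : Measurable Q) (z : SpaceTime n × SpaceTime n) :
    Measurable fun b => lorentz z.1 (q b) + lorentz z.2 (Q b) :=
  (measurable_lorentz_comp hq z.1).add (measurable_lorentz_comp hQ z.2)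

lemma measurable_lorentz_pair (hq : Measurable q) (hQ : Measurable Q) :
    Measurable fun b => lorentz (Q b) (q b) :=
  continuous_lorentz_uncurry.measurable.comp (hQ.prodMk hq)

/-- Only strong continuity is needed: on a fixed `Ω` the multipliers converge pointwise and differ
by at most `1 + 1`. This yields strong measurability of the vector-valued integrand. -/
lemma continuous_phaseMul_osc (hq : Measurable q) (hQ : Measurable Q) (Ω : Lp ℂ 2 ν) :
    Continuous fun z : SpaceTime n × SpaceTime n => phaseMul (measurable_oscPhase hq hQ z) Ω := by
  rw [continuous_iff_continuousAt]
  intro z₀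
  refine tendsto_of_ae_eq_mul (1 + 1)
    (Eventually.of_forall fun z => coeFn_phaseMul (measurable_oscPhase hq hQ z) Ω)
    (coeFn_phaseMul (measurable_oscPhase hq hQ z₀) Ω)
    (Eventually.of_forall fun z b => (norm_sub_le _ _).trans (by
      rw [Complex.norm_exp_ofReal_mul_I, Complex.norm_exp_ofReal_mul_I])) fun b => ?_
  refine Continuous.tendsto (f := fun z : SpaceTime n × SpaceTime n =>
    Complex.exp ((lorentz z.1 (q b) + lorentz z.2 (Q b) : ℝ) * Complex.I)) ?_ z₀
  unfold lorentz
  fun_prop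

lemma integrable_osc (χ : 𝓢(SpaceTime n × SpaceTime n, ℂ)) {ε : ℝ} (hε : ε ≠ 0)
    (hq : Measurable q) (hQ : Measurable Q) (Ω : Lp ℂ 2 ν) :
    Integrable fun z : SpaceTime n × SpaceTime n =>
      oscWeight χ ε z • phaseMul (measurable_oscPhase hq hQ z) Ω := by
  refine ((integrable_oscWeight χ hε).mul_const (‖Ω‖ : ℂ)).congr'
    ((continuous_oscWeight χ ε).smul (continuous_phaseMul_osc hq hQ Ω)).aestronglyMeasurable
    (Eventually.of_forall fun z => ?_)
  rw [norm_smul, LinearIsometry.norm_map, norm_mul, Complex.norm_real, norm_norm]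

lemma continuous_oscIntegral (χ : 𝓢(SpaceTime n × SpaceTime n, ℂ)) {ε : ℝ} (hε : ε ≠ 0) :
    Continuous fun w : SpaceTime n × SpaceTime n => oscIntegral χ ε w.1 w.2 := by
  refine continuous_of_dominated (bound := fun z => ‖oscWeight χ ε z‖)
    (fun w => (integrable_oscWeight_mul_exp χ hε w.1 w.2).aestronglyMeasurable)
    (fun w => Eventually.of_forall fun z => ?_) (integrable_oscWeight χ hε).norm
    (Eventually.of_forall fun z => ?_)
  · rw [norm_mul, Complex.norm_exp_ofReal_mul_I, mul_one]
  · unfold lorentz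
    fun_prop

lemma memLp_oscIntegral_mul (χ : 𝓢(SpaceTime n × SpaceTime n, ℂ)) {ε : ℝ} (hε : ε ≠ 0)
    (hq : Measurable q) (hQ : Measurable Q) (Ω : Lp ℂ 2 ν) :
    MemLp (fun b => oscIntegral χ ε (q b) (Q b) * Ω b) 2 ν := by
  obtain ⟨C, hC⟩ := exists_norm_oscIntegral_le χ
  refine (Lp.memLp Ω).of_le_mul (c := C) ?_ (Eventually.of_forall fun b => ?_)
  · exact (((continuous_oscIntegral χ hε).measurable.comp
      (hq.prodMk hQ)).aestronglyMeasurable).mul (Lp.aestronglyMeasurable Ω)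
  · rw [norm_mul]
    gcongr
    exact hC ε hε _ _

/-- A Bochner integral in `L²` consists of almost everywhere classes and cannot be evaluated
pointwise directly. It is instead paired with an arbitrary `Θ`, and Fubini exchanges the integrals
over `z` and over `b`. -/
lemma coeFn_integral_osc [SigmaFinite ν] (χ : 𝓢(SpaceTime n × SpaceTime n, ℂ)) {ε : ℝ}
    (hε : ε ≠ 0) (hq : Measurable q) (hQ : Measurable Q) (Ω : Lp ℂ 2 ν) :
    (∫ z : SpaceTime n × SpaceTime n,
      oscWeight χ ε z • phaseMul (measurable_oscPhase hq hQ z) Ω : Lp ℂ 2 ν) =ᵐ[ν]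
      fun b => oscIntegral χ ε (q b) (Q b) * Ω b := by
  have hY := memLp_oscIntegral_mul χ hε hq hQ Ω
  suffices h : (∫ z : SpaceTime n × SpaceTime n,
      oscWeight χ ε z • phaseMul (measurable_oscPhase hq hQ z) Ω : Lp ℂ 2 ν) = hY.toLp _ by
    rw [h]; exact hY.coeFn_toLp
  refine ext_inner_left ℂ fun Θ => ?_
  rw [← integral_inner (integrable_osc χ hε hq hQ Ω)]
  have hΘΩ : Integrable (fun b => ⟪Θ b, Ω b⟫_ℂ) ν := L2.integrable_inner Θ Ω
  set e : (SpaceTime n × SpaceTime n) → β → ℂ := fun z b =>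
    oscWeight χ ε z * Complex.exp ((lorentz z.1 (q b) + lorentz z.2 (Q b) : ℝ) * Complex.I) with he
  have h1 : ∀ z, ⟪Θ, oscWeight χ ε z • phaseMul (measurable_oscPhase hq hQ z) Ω⟫_ℂ
      = ∫ b, e z b * ⟪Θ b, Ω b⟫_ℂ ∂ν := by
    intro z
    rw [inner_smul_right, L2.inner_def, ← integral_const_mul]
    refine integral_congr_ae ?_
    filter_upwards [coeFn_phaseMul (measurable_oscPhase hq hQ z) Ω] with b hb
    simp only [hb, he, RCLike.inner_apply]
    ring
  have h2 : ⟪Θ, hY.toLp _⟫_ℂ = ∫ b, (∫ z, e z b * ⟪Θ b, Ω b⟫_ℂ) ∂ν := by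
    rw [L2.inner_def]
    refine integral_congr_ae ?_
    filter_upwards [hY.coeFn_toLp] with b hb
    rw [hb, integral_mul_const, RCLike.inner_apply, RCLike.inner_apply, oscIntegral]
    ring
  rw [h2, integral_congr_ae (Eventually.of_forall h1)]
  refine integral_integral_swap ?_
  -- For Fubini the phase is unimodular, so the integrand has the modulus of a product of two
  -- integrable functions of separate variables.
  have hdom : Integrable (fun w : (SpaceTime n × SpaceTime n) × β =>
      oscWeight χ ε w.1 * ⟪Θ w.2, Ω w.2⟫_ℂ) (volume.prod ν) :=
    (integrable_oscWeight χ hε).mul_prod hΘΩ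
  have hph : Measurable fun w : (SpaceTime n × SpaceTime n) × β =>
      Complex.exp ((lorentz w.1.1 (q w.2) + lorentz w.1.2 (Q w.2) : ℝ) * Complex.I) := by
    have h3 : Measurable fun w : (SpaceTime n × SpaceTime n) × β => lorentz w.1.1 (q w.2) :=
      continuous_lorentz_uncurry.measurable.comp
        (f := fun w : (SpaceTime n × SpaceTime n) × β => (w.1.1, q w.2)) (by fun_prop)
    have h4 : Measurable fun w : (SpaceTime n × SpaceTime n) × β => lorentz w.1.2 (Q w.2) :=
      continuous_lorentz_uncurry.measurable.comp
        (f := fun w : (SpaceTime n × SpaceTime n) × β => (w.1.2, Q w.2)) (by fun_prop)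
    fun_prop
  have heq : (Function.uncurry fun z b => e z b * ⟪Θ b, Ω b⟫_ℂ) = fun w =>
      Complex.exp ((lorentz w.1.1 (q w.2) + lorentz w.1.2 (Q w.2) : ℝ) * Complex.I) *
        (oscWeight χ ε w.1 * ⟪Θ w.2, Ω w.2⟫_ℂ) := by
    ext w
    simp only [Function.uncurry, he]
    ring
  rw [heq]
  refine hdom.congr' (hph.aestronglyMeasurable.mul hdom.aestronglyMeasurable)
    (Eventually.of_forall fun w => ?_)
  simp only [norm_mul, Complex.norm_exp_ofReal_mul_I, one_mul]

/-- Convergence of the regularised oscillatory integrals: the stationary point of the phase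
`-x·y + x·q + y·Q` is `x = Q`, `y = q`. -/
lemma tendsto_integral_osc [SigmaFinite ν] (χ : 𝓢(SpaceTime n × SpaceTime n, ℂ))
    (hχ : χ (0, 0) = 1) (hq : Measurable q) (hQ : Measurable Q) (Ω : Lp ℂ 2 ν) :
    Tendsto (fun ε : ℝ => ((2 * Real.pi) ^ (n + 1))⁻¹ • (∫ z : SpaceTime n × SpaceTime n,
      oscWeight χ ε z • phaseMul (measurable_oscPhase hq hQ z) Ω : Lp ℂ 2 ν)) (𝓝[≠] 0)
      (𝓝 (phaseMul (measurable_lorentz_pair hq hQ) Ω)) := by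
  obtain ⟨C, hC⟩ := exists_norm_oscIntegral_le χ
  -- The bound on the difference of multipliers adds `(2π)^{-d} C`, for the regularised one, and
  -- `1`, for the limiting phase.
  refine tendsto_of_ae_eq_mul (φ := fun ε b =>
      (((2 * Real.pi) ^ (n + 1))⁻¹ : ℝ) * oscIntegral χ ε (q b) (Q b))
    (((2 * Real.pi) ^ (n + 1))⁻¹ * C + 1) ?_ (coeFn_phaseMul _ Ω) ?_ fun b => ?_
  · filter_upwards [self_mem_nhdsWithin] with ε hε
    filter_upwards [coeFn_integral_osc χ hε hq hQ Ω, Lp.coeFn_smul ((2 * Real.pi) ^ (n + 1))⁻¹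
      (∫ z : SpaceTime n × SpaceTime n,
        oscWeight χ ε z • phaseMul (measurable_oscPhase hq hQ z) Ω : Lp ℂ 2 ν)] with b h1 h2
    rw [h2, Pi.smul_apply, h1, Complex.real_smul, mul_assoc]
  · filter_upwards [self_mem_nhdsWithin] with ε hε b
    refine (norm_sub_le _ _).trans ?_
    rw [Complex.norm_exp_ofReal_mul_I, norm_mul, Complex.norm_real,
      Real.norm_of_nonneg (by positivity)]
    gcongr
    exact hC ε hε _ _
  · have h := (tendsto_oscIntegral χ (q b) (Q b)).const_mul
      ((((2 * Real.pi) ^ (n + 1))⁻¹ : ℝ) : ℂ)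
    rwa [hχ, mul_one, ← mul_assoc, ← Complex.ofReal_mul, inv_mul_cancel₀ (by positivity),
      Complex.ofReal_one, one_mul] at h

end OscPhase

/-! ### Covariance of creation and annihilation operators on the sectors -/

/-- A permanent is invariant under permuting rows: reindex `τ ↦ τσ⁻¹`. -/
lemma sum_perm_prod_comp {k : ℕ} (a : Fin k → Fin k → ℂ) (σ : Equiv.Perm (Fin k)) :
    ∑ τ : Equiv.Perm (Fin k), ∏ i, a (σ i) (τ i) = ∑ τ : Equiv.Perm (Fin k), ∏ i, a i (τ i) := by
  refine Fintype.sum_equiv (Equiv.mulRight σ⁻¹) _ _ fun τ => ?_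
  refine Fintype.prod_equiv σ _ _ fun i => ?_
  simp

section FockAlgebra

variable {α : Type*} [MeasurableSpace α] {μ : Measure α} [SigmaFinite μ]

/-- Symmetrised products span a dense subspace, so operator identities on a sector need only be
checked on them. -/
lemma clm_ext_symVec {G : Type*} [NormedAddCommGroup G] [NormedSpace ℂ G] {k : ℕ}
    {A B : Sector μ k →L[ℂ] G} (h : ∀ f : Fin k → OneParticle μ, A (symVec f) = B (symVec f)) :
    A = B := by
  have h1 : (A : Sector μ k →ₗ[ℂ] G) ∘ₗ combi μ k = (B : Sector μ k →ₗ[ℂ] G) ∘ₗ combi μ k := by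
    ext f
    simpa [combi] using h f
  exact DFunLike.coe_injective ((denseRange_combi k).equalizer A.continuous B.continuous
    (funext fun c => LinearMap.congr_fun h1 c))

lemma sector_ext_inner {k : ℕ} {Ψ Φ : Sector μ k}
    (h : ∀ f : Fin k → OneParticle μ, ⟪Ψ, symVec f⟫_ℂ = ⟪Φ, symVec f⟫_ℂ) : Ψ = Φ := by
  have : innerSL ℂ Ψ = innerSL ℂ Φ := clm_ext_symVec fun f => by simpa using h f
  exact ext_inner_right ℂ fun v => by simpa using DFunLike.congr_fun this v

lemma inner_tensorProd_perm_symProd {k : ℕ} (e g : Fin k → OneParticle μ)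
    (σ : Equiv.Perm (Fin k)) :
    ⟪tensorProd fun i => e (σ i), symProd g⟫_ℂ = ⟪tensorProd e, symProd g⟫_ℂ := by
  simp only [symProd, inner_smul_right, inner_sum, inner_tensorProd]
  rw [sum_perm_prod_comp fun i j => ⟪e i, g j⟫_ℂ]

lemma card_perm_inv_mul (k : ℕ) (c : ℂ) :
    ((k.factorial : ℂ)⁻¹) * ∑ _σ : Equiv.Perm (Fin k), c = c := by
  rw [Finset.sum_const, Finset.card_univ, Fintype.card_perm, Fintype.card_fin, nsmul_eq_mul,
    inv_mul_cancel_left₀]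
  exact_mod_cast k.factorial_ne_zero

/-- The left factor is an average of permuted products, and each pairs identically with a symmetric
vector. -/
lemma inner_symProd_symProd {k : ℕ} (e g : Fin k → OneParticle μ) :
    ⟪symProd e, symProd g⟫_ℂ = ⟪tensorProd e, symProd g⟫_ℂ := by
  conv_lhs => rw [symProd]
  simp only [inner_smul_left, sum_inner, inner_tensorProd_perm_symProd, map_inv₀, map_natCast]
  rw [card_perm_inv_mul]

lemma coeFn_tensorProd {k : ℕ} (f : Fin k → OneParticle μ) :
    tensorProd f =ᵐ[piMeasure μ k] fun p => ∏ i, f i (p i) :=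
  (memLp_prod f).coeFn_toLp

lemma coeFn_tensorCons (h : OneParticle μ) {k : ℕ} (Ψ : WaveFunction μ k) :
    tensorCons h Ψ =ᵐ[piMeasure μ (k + 1)] fun p => h (p 0) * Ψ (Fin.tail p) :=
  (memLp_cons h Ψ).coeFn_toLp

@[simp] lemma tensorConsL_apply (h : OneParticle μ) {k : ℕ} (Ψ : WaveFunction μ k) :
    tensorConsL h k Ψ = tensorCons h Ψ := rfl

lemma norm_tensorConsL_le (h : OneParticle μ) (k : ℕ) : ‖tensorConsL h k‖ ≤ ‖h‖ :=
  ContinuousLinearMap.opNorm_le_bound _ (norm_nonneg _) fun Ψ => (norm_tensorCons h Ψ).le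

lemma tensorCons_tensorProd (h : OneParticle μ) {k : ℕ} (f : Fin k → OneParticle μ) :
    tensorCons h (tensorProd f) = tensorProd (Fin.cons h f : Fin (k + 1) → OneParticle μ) := by
  apply Lp.ext
  filter_upwards [coeFn_tensorCons h (tensorProd f),
    coeFn_tensorProd (Fin.cons h f : Fin (k + 1) → OneParticle μ),
    ae_tail (coeFn_tensorProd f)] with p h1 h2 h3
  rw [h1, h2, h3, Fin.prod_univ_succ]
  simp [Fin.tail]

lemma inner_tensorCons_symProd (h : OneParticle μ) {k : ℕ} (f : Fin k → OneParticle μ)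
    (g : Fin (k + 1) → OneParticle μ) :
    ⟪tensorCons h (symProd f), symProd g⟫_ℂ
      = ⟪symProd (Fin.cons h f : Fin (k + 1) → OneParticle μ), symProd g⟫_ℂ := by
  have hσ : ∀ σ : Equiv.Perm (Fin k),
      ⟪tensorProd (Fin.cons h (fun i => f (σ i)) : Fin (k + 1) → OneParticle μ), symProd g⟫_ℂ
        = ⟪tensorProd (Fin.cons h f : Fin (k + 1) → OneParticle μ), symProd g⟫_ℂ := by
    intro σ
    -- A permutation of the last `k` slots extends to `k + 1` slots fixing `0`; a symmetric vector
    -- does not see it.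
    rw [← inner_tensorProd_perm_symProd (Fin.cons h f : Fin (k + 1) → OneParticle μ) g
      (Equiv.Perm.decomposeFin.symm (0, σ))]
    congr 2
    ext1 i
    refine Fin.cases ?_ (fun j => ?_) i
    · simp
    · simp
  rw [inner_symProd_symProd, ← tensorConsL_apply, symProd, map_smul, map_sum]
  simp only [inner_smul_left, sum_inner, tensorConsL_apply, tensorCons_tensorProd, hσ, map_inv₀,
    map_natCast]
  rw [card_perm_inv_mul]

/-- The orthogonal projection is never computed: paired with symmetric vectors it disappears, and
such pairings determine an element of the sector. -/
lemma sectorCreate_symVec (h : OneParticle μ) {k : ℕ} (f : Fin k → OneParticle μ) :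
    sectorCreate h k (symVec f) = ((Real.sqrt ((k : ℝ) + 1) : ℝ) : ℂ) •
      symVec (Fin.cons h f : Fin (k + 1) → OneParticle μ) := by
  rw [sectorCreate, smul_apply]
  congr 1
  refine sector_ext_inner fun g => ?_
  simp only [ContinuousLinearMap.comp_apply, Submodule.inner_orthogonalProjectionOnto_eq_of_mem_right]
  exact inner_tensorCons_symProd h f g

lemma sectorGamma_sectorCreate (W : OneParticle μ →ₗᵢ[ℂ] OneParticle μ) (h : OneParticle μ) {k : ℕ}
    (Ψ : Sector μ k) :
    sectorGamma W (k + 1) (sectorCreate h k Ψ) = sectorCreate (W h) k (sectorGamma W k Ψ) := by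
  have : (sectorGamma W (k + 1)).comp (sectorCreate h k)
      = (sectorCreate (W h) k).comp (sectorGamma W k) := by
    refine clm_ext_symVec fun f => ?_
    simp only [ContinuousLinearMap.comp_apply, sectorCreate_symVec, map_smul, sectorGamma_symVec]
    congr 2
    ext1 i
    refine Fin.cases ?_ (fun j => ?_) i <;> simp
  exact DFunLike.congr_fun this Ψ

lemma sectorGamma_symm_apply (W : OneParticle μ ≃ₗᵢ[ℂ] OneParticle μ) {k : ℕ} (Ψ : Sector μ k) :
    sectorGamma W.symm.toLinearIsometry k (sectorGamma W.toLinearIsometry k Ψ) = Ψ := by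
  have : (sectorGamma W.symm.toLinearIsometry k).comp (sectorGamma W.toLinearIsometry k)
      = ContinuousLinearMap.id ℂ _ := by
    refine clm_ext_symVec fun f => ?_
    simp [sectorGamma_symVec]
  exact DFunLike.congr_fun this Ψ

lemma sectorGamma_apply_symm (W : OneParticle μ ≃ₗᵢ[ℂ] OneParticle μ) {k : ℕ} (Ψ : Sector μ k) :
    sectorGamma W.toLinearIsometry k (sectorGamma W.symm.toLinearIsometry k Ψ) = Ψ :=
  sectorGamma_symm_apply W.symm Ψ

lemma inner_sectorGamma_left (W : OneParticle μ ≃ₗᵢ[ℂ] OneParticle μ) {k : ℕ} (Ψ Φ : Sector μ k) :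
    ⟪sectorGamma W.toLinearIsometry k Ψ, Φ⟫_ℂ = ⟪Ψ, sectorGamma W.symm.toLinearIsometry k Φ⟫_ℂ := by
  conv_lhs => rw [← sectorGamma_apply_symm W Φ]
  exact LinearIsometry.inner_map_map
    (⟨(sectorGamma W.toLinearIsometry k : Sector μ k →ₗ[ℂ] Sector μ k),
      norm_sectorGamma W.toLinearIsometry k⟩ : Sector μ k →ₗᵢ[ℂ] Sector μ k) _ _

/-- This is the adjoint of the covariance of creation. It uses that `Γ(W)` is unitary, so `W` must
be invertible here. -/
lemma sectorGamma_sectorCreate_adjoint (W : OneParticle μ ≃ₗᵢ[ℂ] OneParticle μ)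
    (h : OneParticle μ) {k : ℕ} (Ψ : Sector μ (k + 1)) :
    sectorGamma W.toLinearIsometry k ((sectorCreate h k).adjoint Ψ)
      = (sectorCreate (W h) k).adjoint (sectorGamma W.toLinearIsometry (k + 1) Ψ) := by
  refine ext_inner_right ℂ fun Φ => ?_
  rw [inner_sectorGamma_left, ContinuousLinearMap.adjoint_inner_left,
    ContinuousLinearMap.adjoint_inner_left, inner_sectorGamma_left, sectorGamma_sectorCreate]
  simp

variable (μ) in
/-- `√(k+1) P_{k+1}` on `(k+1)`-particle wave functions. -/
def createProj (k : ℕ) : WaveFunction μ (k + 1) →L[ℂ] Sector μ (k + 1) :=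
  ((Real.sqrt ((k : ℝ) + 1) : ℝ) : ℂ) • (symSubspace μ (k + 1)).orthogonalProjectionOnto

/-- `√(k+1) P_k ⟨h|` on `(k+1)`-particle wave functions, with `⟨h|` the contraction of the first
variable with `h`. -/
def annihilateProj (h : OneParticle μ) (k : ℕ) : WaveFunction μ (k + 1) →L[ℂ] Sector μ k :=
  ((Real.sqrt ((k : ℝ) + 1) : ℝ) : ℂ) •
    ((symSubspace μ k).orthogonalProjectionOnto.comp (tensorConsL h k).adjoint)

lemma sectorCreate_eq (h : OneParticle μ) {k : ℕ} (Ψ : Sector μ k) :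
    sectorCreate h k Ψ = createProj μ k (tensorCons h (Ψ : WaveFunction μ k)) := rfl

/-- The adjoint is expressed through arbitrary wave functions because the phases to be inserted
single out the first variable and need not preserve symmetry. -/
lemma sectorCreate_adjoint_eq (h : OneParticle μ) {k : ℕ} (Ψ : Sector μ (k + 1)) :
    (sectorCreate h k).adjoint Ψ = annihilateProj h k (Ψ : WaveFunction μ (k + 1)) := by
  refine ext_inner_right ℂ fun Φ => ?_
  rw [ContinuousLinearMap.adjoint_inner_left, annihilateProj, sectorCreate,
    smul_apply, smul_apply, inner_smul_left,
    inner_smul_right, Complex.conj_ofReal, ContinuousLinearMap.comp_apply,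
    ContinuousLinearMap.comp_apply, ContinuousLinearMap.comp_apply,
    Submodule.inner_orthogonalProjectionOnto_eq_of_mem_left,
    Submodule.inner_orthogonalProjectionOnto_eq_of_mem_right,
    ContinuousLinearMap.adjoint_inner_left]
  rfl

lemma norm_createProj_le (k : ℕ) (Ψ : WaveFunction μ (k + 1)) :
    ‖createProj μ k Ψ‖ ≤ Real.sqrt ((k : ℝ) + 1) * ‖Ψ‖ := by
  rw [createProj, smul_apply, norm_smul, Complex.norm_real,
    Real.norm_of_nonneg (Real.sqrt_nonneg _)]
  gcongr
  exact Submodule.norm_orthogonalProjectionOnto_apply_le _ _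

lemma norm_tensorConsL_adjoint_le (h : OneParticle μ) {k : ℕ} (Ψ : WaveFunction μ (k + 1)) :
    ‖(tensorConsL h k).adjoint Ψ‖ ≤ ‖h‖ * ‖Ψ‖ := by
  refine ContinuousLinearMap.le_of_opNorm_le _ ?_ Ψ
  have := LinearIsometryEquiv.norm_map (ContinuousLinearMap.adjoint (𝕜 := ℂ)) (tensorConsL h k)
  rw [this]
  exact norm_tensorConsL_le h k

lemma norm_annihilateProj_le (h : OneParticle μ) (k : ℕ) (Ψ : WaveFunction μ (k + 1)) :
    ‖annihilateProj h k Ψ‖ ≤ Real.sqrt ((k : ℝ) + 1) * (‖h‖ * ‖Ψ‖) := by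
  rw [annihilateProj, smul_apply, norm_smul, Complex.norm_real,
    Real.norm_of_nonneg (Real.sqrt_nonneg _)]
  refine mul_le_mul_of_nonneg_left ?_ (Real.sqrt_nonneg _)
  rw [ContinuousLinearMap.comp_apply]
  exact (Submodule.norm_orthogonalProjectionOnto_apply_le _ _).trans
    (norm_tensorConsL_adjoint_le h Ψ)

lemma tensorCons_phaseMul_right (h : OneParticle μ) {k : ℕ} {s : (Fin k → α) → ℝ}
    {t : (Fin (k + 1) → α) → ℝ} (hs : Measurable s) (ht : Measurable t)
    (hst : ∀ p, t p = s (Fin.tail p)) (Ψ : WaveFunction μ k) :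
    tensorCons h (phaseMul hs Ψ) = phaseMul ht (tensorCons h Ψ) := by
  apply Lp.ext
  filter_upwards [coeFn_tensorCons h (phaseMul hs Ψ), ae_tail (coeFn_phaseMul hs Ψ),
    coeFn_phaseMul ht (tensorCons h Ψ), coeFn_tensorCons h Ψ] with p h1 h2 h3 h4
  rw [h1, h2, h3, h4, hst p]
  ring

end FockAlgebra

/-! ### Translations as multiplications by phases -/

section Translations

variable {n : ℕ} {m : ℝ}

lemma coeFn_translate1 (y : SpaceTime n) (ψ : H1 n m) :
    translate1 y ψ =ᵐ[shellMeasure n m]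
      fun p => Complex.exp (Complex.I * lorentz y (onShell m p)) * ψ p :=
  (memLp_phase y ψ).coeFn_toLp

lemma measurable_onShell_eval (m : ℝ) {k : ℕ} (i : Fin k) :
    Measurable fun p : Fin k → Mom n => onShell m (p i) :=
  (continuous_onShell m).measurable.comp (measurable_pi_apply i)

/-- The total energy-momentum of `k` particles. -/
def totalMomentum (m : ℝ) {k : ℕ} (p : Fin k → Mom n) : SpaceTime n := ∑ i, onShell m (p i)

lemma measurable_totalMomentum (m : ℝ) (k : ℕ) :
    Measurable (totalMomentum m : (Fin k → Mom n) → SpaceTime n) := by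
  unfold totalMomentum
  exact Finset.measurable_sum _ fun i _ => measurable_onShell_eval m i

lemma measurable_totalMomentum_tail (m : ℝ) (k : ℕ) :
    Measurable fun p : Fin (k + 1) → Mom n => totalMomentum m (Fin.tail p) := by
  refine (measurable_totalMomentum m k).comp (measurable_pi_lambda _ fun i => ?_)
  exact measurable_pi_apply _

lemma lorentz_totalMomentum (m : ℝ) {k : ℕ} (y : SpaceTime n) (p : Fin k → Mom n) :
    lorentz y (totalMomentum m p) = ∑ i, lorentz y (onShell m (p i)) := by
  simp only [lorentz_eq_inner, totalMomentum, inner_sum]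

lemma tensorProd_translate1 (y : SpaceTime n) {k : ℕ} (f : Fin k → H1 n m) :
    tensorProd (fun i => translate1 y (f i))
      = phaseMul (measurable_lorentz_comp (measurable_totalMomentum m k) y) (tensorProd f) := by
  apply Lp.ext
  have h : ∀ᵐ p ∂piMeasure (shellMeasure n m) k, ∀ i, translate1 y (f i) (p i)
      = Complex.exp (Complex.I * lorentz y (onShell m (p i))) * f i (p i) :=
    ae_all_iff.2 fun i => (Measure.quasiMeasurePreserving_eval
      (fun _ : Fin k => shellMeasure n m) i).ae (coeFn_translate1 y (f i))
  filter_upwards [coeFn_tensorProd fun i => translate1 y (f i), coeFn_tensorProd f, h,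
    coeFn_phaseMul (measurable_lorentz_comp (measurable_totalMomentum m k) y) (tensorProd f)]
    with p h1 h2 h3 h4
  rw [h1, h4, h2, Finset.prod_congr rfl fun i _ => h3 i, Finset.prod_mul_distrib,
    ← Complex.exp_sum, lorentz_totalMomentum, ← Finset.mul_sum]
  push_cast
  rw [mul_comm Complex.I]

/-- On products the one-particle phases multiply to the phase of the total momentum; density does
the rest. -/
lemma coe_sectorGamma_translate1 (y : SpaceTime n) {k : ℕ} (Ψ : Sector (shellMeasure n m) k) :
    (sectorGamma (translate1 y).toLinearIsometry k Ψ : WaveFunction (shellMeasure n m) k)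
      = phaseMul (measurable_lorentz_comp (measurable_totalMomentum m k) y)
        (Ψ : WaveFunction (shellMeasure n m) k) := by
  have : (symSubspace (shellMeasure n m) k).subtypeL.comp
      (sectorGamma (translate1 y).toLinearIsometry k)
      = (phaseMul (measurable_lorentz_comp (measurable_totalMomentum m k)
        y)).toContinuousLinearMap.comp (symSubspace (shellMeasure n m) k).subtypeL := by
    refine clm_ext_symVec fun f => ?_
    simp only [ContinuousLinearMap.comp_apply, sectorGamma_symVec]
    simp only [Submodule.subtypeL_apply, symVec, LinearIsometry.coe_toContinuousLinearMap, symProd,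
      map_smul, map_sum, ← tensorProd_translate1]
    rfl
  exact DFunLike.congr_fun this Ψ

lemma tensorCons_translate1 (v : SpaceTime n) (g : H1 n m) {k : ℕ}
    (Ψ : WaveFunction (shellMeasure n m) k) :
    tensorCons (translate1 v g) Ψ
      = phaseMul (measurable_lorentz_comp (measurable_onShell_eval m 0) v) (tensorCons g Ψ) := by
  apply Lp.ext
  have h := (Measure.quasiMeasurePreserving_eval
      (fun _ : Fin (k + 1) => shellMeasure n m) 0).ae (coeFn_translate1 v g)
  filter_upwards [coeFn_tensorCons (translate1 v g) Ψ, coeFn_tensorCons g Ψ, h,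
    coeFn_phaseMul (measurable_lorentz_comp (measurable_onShell_eval m 0) v) (tensorCons g Ψ)]
    with p h1 h2 h3 h4
  rw [h1, h4, h2]
  simp only [Function.eval] at h3
  rw [h3, mul_comm Complex.I, mul_assoc]

/-- Contraction is antilinear in `g`, so the phase passes to the wave function with the opposite
sign. -/
lemma annihilateProj_translate1 (v : SpaceTime n) (g : H1 n m) {k : ℕ}
    (Ψ : WaveFunction (shellMeasure n m) (k + 1)) :
    annihilateProj (translate1 v g) k Ψ = annihilateProj g k
      (phaseMul (measurable_lorentz_comp (measurable_onShell_eval m 0) (-v)) Ψ) := by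
  have h : (tensorConsL (translate1 v g) k).adjoint Ψ = (tensorConsL g k).adjoint
      (phaseMul (measurable_lorentz_comp (measurable_onShell_eval m 0) (-v)) Ψ) := by
    refine ext_inner_left ℂ fun Φ => ?_
    rw [ContinuousLinearMap.adjoint_inner_right, ContinuousLinearMap.adjoint_inner_right,
      tensorConsL_apply, tensorConsL_apply, tensorCons_translate1]
    exact inner_phaseMul_left _ _ (fun p => by simp [lorentz_eq_inner]) _ _
  simp only [annihilateProj, smul_apply, ContinuousLinearMap.comp_apply, h]

/-- The vector `θ p₀`, where `p₀` is the energy-momentum of the first particle. -/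
def leadMomentum (m : ℝ) (θ : Matrix (Fin (n + 1)) (Fin (n + 1)) ℝ) {k : ℕ}
    (p : Fin (k + 1) → Mom n) : SpaceTime n :=
  Matrix.toEuclideanLin θ (onShell m (p 0))

lemma measurable_leadMomentum (m : ℝ) (θ : Matrix (Fin (n + 1)) (Fin (n + 1)) ℝ) (k : ℕ) :
    Measurable (leadMomentum m θ : (Fin (k + 1) → Mom n) → SpaceTime n) :=
  (LinearMap.continuous_of_finiteDimensional (Matrix.toEuclideanLin θ)).measurable.comp
    (measurable_onShell_eval m 0)

lemma sectorCreate_translate1 {θ : Matrix (Fin (n + 1)) (Fin (n + 1)) ℝ} (hθ : IsLorentzSkew θ)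
    (g : H1 n m) {k : ℕ} (Ψ : Sector (shellMeasure n m) k) (z : SpaceTime n × SpaceTime n) :
    sectorCreate (translate1 (Matrix.toEuclideanLin θ z.1) g) k
        (sectorGamma (translate1 z.2).toLinearIsometry k Ψ)
      = createProj (shellMeasure n m) k
        (phaseMul (measurable_oscPhase (measurable_leadMomentum m θ k).neg
          (measurable_totalMomentum_tail m k) z)
          (tensorCons g (Ψ : WaveFunction (shellMeasure n m) k))) := by
  rw [sectorCreate_eq, coe_sectorGamma_translate1, tensorCons_translate1,
    tensorCons_phaseMul_right g _
      (measurable_lorentz_comp (measurable_totalMomentum_tail m k) z.2) fun p => rfl]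
  congr 1
  refine phaseMul_phaseMul _ _ _ (fun p => ?_) _
  -- Skew-symmetry gives `θx·p₀ = -x·θp₀`, hence `q = -θp₀`.
  rw [hθ]
  simp [lorentz_eq_inner, leadMomentum]

lemma sectorCreate_adjoint_translate1 {θ : Matrix (Fin (n + 1)) (Fin (n + 1)) ℝ}
    (hθ : IsLorentzSkew θ) (g : H1 n m) {k : ℕ} (Ψ : Sector (shellMeasure n m) (k + 1))
    (z : SpaceTime n × SpaceTime n) :
    (sectorCreate (translate1 (Matrix.toEuclideanLin θ z.1) g) k).adjoint
        (sectorGamma (translate1 z.2).toLinearIsometry (k + 1) Ψ)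
      = annihilateProj g k
        (phaseMul (measurable_oscPhase (measurable_leadMomentum m θ k)
          (measurable_totalMomentum m (k + 1)) z)
          (Ψ : WaveFunction (shellMeasure n m) (k + 1))) := by
  rw [sectorCreate_adjoint_eq, coe_sectorGamma_translate1, annihilateProj_translate1]
  congr 1
  refine phaseMul_phaseMul _ _ _ (fun p => ?_) _
  -- Two signs cancel, one from antilinearity and one from skew-symmetry, so `q = +θp₀`. Here `Q`
  -- includes `p₀`, which is harmless since `p₀·θp₀ = 0`.
  have : lorentz (-Matrix.toEuclideanLin θ z.1) (onShell m (p 0))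
      = lorentz z.1 (Matrix.toEuclideanLin θ (onShell m (p 0))) := by
    have := hθ z.1 (onShell m (p 0))
    simp only [lorentz_eq_inner, map_neg, inner_neg_left] at this ⊢
    rw [this, neg_neg]
  rw [this, leadMomentum]

end Translations

/-! ### Operators on finite particle vectors: sectors and norms -/

section FiniteParticle

variable {α : Type*} [MeasurableSpace α] {μ : Measure α} [SigmaFinite μ]

lemma inclSector_apply_self {k : ℕ} (Ψ : Sector μ k) : (inclSector μ k Ψ : Fock μ) k = Ψ :=
  lp.single_apply_self (E := fun k : ℕ => Sector μ k) 2 k Ψ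

lemma inclSector_apply_ne {k j : ℕ} (Ψ : Sector μ k) (h : j ≠ k) :
    (inclSector μ k Ψ : Fock μ) j = 0 :=
  lp.single_apply_ne (E := fun k : ℕ => Sector μ k) 2 k Ψ h

lemma diagOp_inclSector (A : (k : ℕ) → Sector μ k →ₗ[ℂ] Sector μ k) {k : ℕ} (Ψ : Sector μ k) :
    diagOp A (inclSector μ k Ψ) = inclSector μ k (A k Ψ) := by
  refine finiteParticle_ext fun j => ?_
  change A j ((inclSector μ k Ψ : Fock μ) j) = _
  rcases eq_or_ne j k with rfl | h
  · rw [inclSector_apply_self, inclSector_apply_self]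
  · rw [inclSector_apply_ne _ h, inclSector_apply_ne _ h, map_zero]

lemma raiseOp_inclSector (A : (k : ℕ) → Sector μ k →ₗ[ℂ] Sector μ (k + 1)) {k : ℕ}
    (Ψ : Sector μ k) : raiseOp A (inclSector μ k Ψ) = inclSector μ (k + 1) (A k Ψ) := by
  refine finiteParticle_ext fun j => ?_
  cases j with
  | zero => exact (inclSector_apply_ne _ (Nat.succ_ne_zero k).symm).symm
  | succ j =>
    change A j ((inclSector μ k Ψ : Fock μ) j) = _
    rcases eq_or_ne j k with rfl | h
    · rw [inclSector_apply_self, inclSector_apply_self]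
    · rw [inclSector_apply_ne _ h, inclSector_apply_ne _ (by omega), map_zero]

lemma lowerOp_inclSector_succ (A : (k : ℕ) → Sector μ (k + 1) →ₗ[ℂ] Sector μ k) {k : ℕ}
    (Ψ : Sector μ (k + 1)) : lowerOp A (inclSector μ (k + 1) Ψ) = inclSector μ k (A k Ψ) := by
  refine finiteParticle_ext fun j => ?_
  change A j ((inclSector μ (k + 1) Ψ : Fock μ) (j + 1)) = _
  rcases eq_or_ne j k with rfl | h
  · rw [inclSector_apply_self, inclSector_apply_self]
  · rw [inclSector_apply_ne _ h, inclSector_apply_ne _ (by omega), map_zero]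

lemma lowerOp_inclSector_zero (A : (k : ℕ) → Sector μ (k + 1) →ₗ[ℂ] Sector μ k)
    (Ψ : Sector μ 0) : lowerOp A (inclSector μ 0 Ψ) = 0 := by
  refine finiteParticle_ext fun j => ?_
  change A j ((inclSector μ 0 Ψ : Fock μ) (j + 1)) = 0
  rw [inclSector_apply_ne _ (Nat.succ_ne_zero j), map_zero]

lemma coe_sum_apply {ι : Type*} (s : Finset ι) (F : ι → finiteParticle μ) (j : ℕ) :
    ((∑ i ∈ s, F i : finiteParticle μ) : Fock μ) j = ∑ i ∈ s, (F i : Fock μ) j := by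
  classical
  induction s using Finset.induction_on with
  | empty => rfl
  | insert a s ha ih =>
    rw [Finset.sum_insert ha, Finset.sum_insert ha, ← ih]
    rfl

lemma exists_eq_sum_inclSector (Ψ : finiteParticle μ) :
    ∃ K : ℕ, Ψ = ∑ k ∈ Finset.range K, inclSector μ k ((Ψ : Fock μ) k) := by
  obtain ⟨K, hK⟩ := Ψ.2
  refine ⟨K, finiteParticle_ext fun j => ?_⟩
  rw [coe_sum_apply]
  by_cases hj : j < K
  · rw [Finset.sum_eq_single_of_mem j (Finset.mem_range.2 hj)
      fun i _ hi => inclSector_apply_ne _ hi.symm, inclSector_apply_self]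
  · rw [hK j (not_lt.1 hj), Finset.sum_eq_zero fun i hi =>
      inclSector_apply_ne _ (by rw [Finset.mem_range] at hi; omega)]

lemma hasSum_norm_sq (Ψ : finiteParticle μ) :
    HasSum (fun k => ‖(Ψ : Fock μ) k‖ ^ 2) (‖Ψ‖ ^ 2) := by
  have := lp.hasSum_norm (p := 2) (by norm_num) (Ψ : Fock μ)
  simpa using this

lemma norm_diagOp_eq {A : (k : ℕ) → Sector μ k →ₗ[ℂ] Sector μ k}
    (hA : ∀ k Ψ, ‖A k Ψ‖ = ‖Ψ‖) (Ψ : finiteParticle μ) : ‖diagOp A Ψ‖ = ‖Ψ‖ := by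
  have h1 := hasSum_norm_sq (diagOp A Ψ)
  have h2 : (fun k => ‖(diagOp A Ψ : Fock μ) k‖ ^ 2) = fun k => ‖(Ψ : Fock μ) k‖ ^ 2 :=
    funext fun k => congrArg (· ^ 2) (hA k _)
  rw [h2] at h1
  exact (pow_left_inj₀ (norm_nonneg _) (norm_nonneg _) two_ne_zero).1
    (h1.unique (hasSum_norm_sq Ψ))

lemma norm_secondQuant (W : OneParticle μ ≃ₗᵢ[ℂ] OneParticle μ) (Ψ : finiteParticle μ) :
    ‖secondQuant W Ψ‖ = ‖Ψ‖ :=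
  norm_diagOp_eq (fun k Φ => norm_sectorGamma W.toLinearIsometry k Φ) Ψ

lemma sqrtNumberAddOne_secondQuant (W : OneParticle μ ≃ₗᵢ[ℂ] OneParticle μ)
    (Ψ : finiteParticle μ) :
    sqrtNumberAddOne μ (secondQuant W Ψ) = secondQuant W (sqrtNumberAddOne μ Ψ) :=
  finiteParticle_ext fun k => (map_smul (sectorGamma W.toLinearIsometry k)
    ((Real.sqrt ((k : ℝ) + 1) : ℝ) : ℂ) ((Ψ : Fock μ) k)).symm

lemma norm_sqrtNumberAddOne_secondQuant (W : OneParticle μ ≃ₗᵢ[ℂ] OneParticle μ)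
    (Ψ : finiteParticle μ) : ‖sqrtNumberAddOne μ (secondQuant W Ψ)‖ = ‖sqrtNumberAddOne μ Ψ‖ := by
  rw [sqrtNumberAddOne_secondQuant, norm_secondQuant]

lemma norm_sqrtNumberAddOne_apply (Ψ : finiteParticle μ) (k : ℕ) :
    ‖(sqrtNumberAddOne μ Ψ : Fock μ) k‖ = Real.sqrt ((k : ℝ) + 1) * ‖(Ψ : Fock μ) k‖ := by
  change ‖((Real.sqrt ((k : ℝ) + 1) : ℝ) : ℂ) • (Ψ : Fock μ) k‖ = _
  rw [norm_smul, Complex.norm_real, Real.norm_of_nonneg (Real.sqrt_nonneg _)]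

lemma norm_raiseOp_le {A : (k : ℕ) → Sector μ k →ₗ[ℂ] Sector μ (k + 1)} {C : ℝ} (hC : 0 ≤ C)
    (hA : ∀ k Ψ, ‖A k Ψ‖ ≤ C * (Real.sqrt ((k : ℝ) + 1) * ‖Ψ‖)) (Ψ : finiteParticle μ) :
    ‖raiseOp A Ψ‖ ≤ C * ‖sqrtNumberAddOne μ Ψ‖ := by
  refine le_of_sq_le_sq ?_ (by positivity)
  -- The vacuum component of the image vanishes, so the sum may be shifted by one and compared with
  -- the source sector by sector.
  have h1 := (hasSum_nat_add_iff' 1).2 (hasSum_norm_sq (raiseOp A Ψ))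
  have h0 : (raiseOp A Ψ : Fock μ) 0 = 0 := rfl
  rw [Finset.sum_range_one, h0, norm_zero, zero_pow two_ne_zero, sub_zero] at h1
  rw [mul_pow]
  refine hasSum_le (fun k => ?_) h1 ((hasSum_norm_sq (sqrtNumberAddOne μ Ψ)).mul_left (C ^ 2))
  rw [← mul_pow, norm_sqrtNumberAddOne_apply]
  exact pow_le_pow_left₀ (norm_nonneg _) (hA k _) 2

lemma norm_lowerOp_le {A : (k : ℕ) → Sector μ (k + 1) →ₗ[ℂ] Sector μ k} {C : ℝ} (hC : 0 ≤ C)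
    (hA : ∀ k Ψ, ‖A k Ψ‖ ≤ C * (Real.sqrt ((k : ℝ) + 1) * ‖Ψ‖)) (Ψ : finiteParticle μ) :
    ‖lowerOp A Ψ‖ ≤ C * ‖sqrtNumberAddOne μ Ψ‖ := by
  refine le_of_sq_le_sq ?_ (by positivity)
  have h1 := (hasSum_nat_add_iff' 1).2 (hasSum_norm_sq (sqrtNumberAddOne μ Ψ))
  have h2 := hasSum_le (fun k => ?_) (hasSum_norm_sq (lowerOp A Ψ)) (h1.mul_left (C ^ 2))
  · refine h2.trans ?_
    rw [mul_pow, Finset.sum_range_one]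
    gcongr
    exact sub_le_self _ (sq_nonneg _)
  · rw [← mul_pow, norm_sqrtNumberAddOne_apply]
    refine pow_le_pow_left₀ (norm_nonneg _) ((hA k _).trans ?_) 2
    -- On the `(k+1)`-particle sector `(N+1)^{1/2}` equals `√(k+2)`, which dominates the required
    -- `√(k+1)`.
    push_cast
    gcongr
    linarith

end FiniteParticle

/-! ### The deformed operators -/

section Warp

variable {n : ℕ} {m : ℝ} {θ : Matrix (Fin (n + 1)) (Fin (n + 1)) ℝ} {V : H1 n m ≃ₗᵢ[ℂ] H1 n m}

/-- The deformed creation operator on the `k`-particle sector: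
`Ψ ↦ √(k+1) P_{k+1} (e^{-i (p₁+⋯+p_k)·θp₀} g ⊗ Ψ)`. -/
def warpedSectorCreate (θ : Matrix (Fin (n + 1)) (Fin (n + 1)) ℝ) (g : H1 n m) (k : ℕ) :
    Sector (shellMeasure n m) k →ₗ[ℂ] Sector (shellMeasure n m) (k + 1) :=
  (((createProj (shellMeasure n m) k).comp
    (phaseMul (measurable_lorentz_pair (measurable_leadMomentum m θ k).neg
      (measurable_totalMomentum_tail m k))).toContinuousLinearMap).comp
    ((tensorConsL g k).comp (symSubspace (shellMeasure n m) k).subtypeL)).toLinearMap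

/-- The deformed annihilation operator on the `(k+1)`-particle sector:
`Ψ ↦ √(k+1) P_k ⟨g| e^{i (p₀+⋯+p_k)·θp₀} Ψ`. -/
def warpedSectorAnnihilate (θ : Matrix (Fin (n + 1)) (Fin (n + 1)) ℝ) (g : H1 n m) (k : ℕ) :
    Sector (shellMeasure n m) (k + 1) →ₗ[ℂ] Sector (shellMeasure n m) k :=
  (((annihilateProj g k).comp
    (phaseMul (measurable_lorentz_pair (measurable_leadMomentum m θ k)
      (measurable_totalMomentum m (k + 1)))).toContinuousLinearMap).comp
    (symSubspace (shellMeasure n m) (k + 1)).subtypeL).toLinearMap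

/-- The deformed creation operator `a*_{θ,X}(h)`. -/
def warpedCreate (θ : Matrix (Fin (n + 1)) (Fin (n + 1)) ℝ) (V : H1 n m ≃ₗᵢ[ℂ] H1 n m)
    (h : H1 n m) : finiteParticle (shellMeasure n m) →ₗ[ℂ] finiteParticle (shellMeasure n m) :=
  secondQuant V.symm ∘ₗ raiseOp (warpedSectorCreate θ (V h)) ∘ₗ secondQuant V

/-- The deformed annihilation operator `a_{θ,X}(h)`. -/
def warpedAnnihilate (θ : Matrix (Fin (n + 1)) (Fin (n + 1)) ℝ) (V : H1 n m ≃ₗᵢ[ℂ] H1 n m)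
    (h : H1 n m) : finiteParticle (shellMeasure n m) →ₗ[ℂ] finiteParticle (shellMeasure n m) :=
  secondQuant V.symm ∘ₗ lowerOp (warpedSectorAnnihilate θ (V h)) ∘ₗ secondQuant V

lemma norm_warpedCreate_le (h : H1 n m) (Ψ : finiteParticle (shellMeasure n m)) :
    ‖warpedCreate θ V h Ψ‖ ≤ ‖h‖ * ‖sqrtNumberAddOne (shellMeasure n m) Ψ‖ := by
  rw [warpedCreate, LinearMap.comp_apply, LinearMap.comp_apply, norm_secondQuant,
    ← norm_sqrtNumberAddOne_secondQuant V Ψ, ← V.norm_map h]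
  refine norm_raiseOp_le (norm_nonneg _) (fun k Φ => ?_) _
  refine (norm_createProj_le k _).trans ?_
  refine (mul_le_mul_of_nonneg_left ((LinearIsometry.norm_map _ _).trans
    (norm_tensorCons (V h) _)).le (Real.sqrt_nonneg _)).trans ?_
  rw [mul_left_comm]
  rfl

lemma norm_warpedAnnihilate_le (h : H1 n m) (Ψ : finiteParticle (shellMeasure n m)) :
    ‖warpedAnnihilate θ V h Ψ‖ ≤ ‖h‖ * ‖sqrtNumberAddOne (shellMeasure n m) Ψ‖ := by
  rw [warpedAnnihilate, LinearMap.comp_apply, LinearMap.comp_apply, norm_secondQuant,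
    ← norm_sqrtNumberAddOne_secondQuant V Ψ, ← V.norm_map h]
  refine norm_lowerOp_le (norm_nonneg _) (fun k Φ => ?_) _
  refine (norm_annihilateProj_le (V h) k _).trans ?_
  rw [mul_left_comm]
  exact mul_le_mul_of_nonneg_left (mul_le_mul_of_nonneg_left (LinearIsometry.norm_map _ _).le
    (Real.sqrt_nonneg _)) (norm_nonneg _)

/-! ### Additivity of the deformation and reduction to single sectors -/

lemma IsWarped.add_right
    {A : finiteParticle (shellMeasure n m) →ₗ[ℂ] finiteParticle (shellMeasure n m)}
    {Φ₁ Φ₂ : finiteParticle (shellMeasure n m)} {Ξ₁ Ξ₂ : Fock (shellMeasure n m)}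
    (h₁ : IsWarped θ V A Φ₁ Ξ₁) (h₂ : IsWarped θ V A Φ₂ Ξ₂) :
    IsWarped θ V A (Φ₁ + Φ₂) (Ξ₁ + Ξ₂) := by
  intro χ hχ
  have heq : ∀ ε, warpIntegrand θ V A (Φ₁ + Φ₂) χ ε
      = fun z => warpIntegrand θ V A Φ₁ χ ε z + warpIntegrand θ V A Φ₂ χ ε z := by
    intro ε
    ext1 z
    simp only [warpIntegrand, map_add, Submodule.coe_add, smul_add]
  refine ⟨fun ε hε => ?_, ?_⟩
  · rw [heq]
    exact ((h₁ χ hχ).1 ε hε).add ((h₂ χ hχ).1 ε hε)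
  · refine ((h₁ χ hχ).2.add (h₂ χ hχ).2).congr' ?_
    filter_upwards [self_mem_nhdsWithin] with ε hε
    rw [heq, integral_add ((h₁ χ hχ).1 ε hε) ((h₂ χ hχ).1 ε hε), smul_add]

lemma IsWarped.add_op
    {A B : finiteParticle (shellMeasure n m) →ₗ[ℂ] finiteParticle (shellMeasure n m)}
    {Φ : finiteParticle (shellMeasure n m)} {Ξ₁ Ξ₂ : Fock (shellMeasure n m)}
    (h₁ : IsWarped θ V A Φ Ξ₁) (h₂ : IsWarped θ V B Φ Ξ₂) :
    IsWarped θ V (A + B) Φ (Ξ₁ + Ξ₂) := by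
  intro χ hχ
  have heq : ∀ ε, warpIntegrand θ V (A + B) Φ χ ε
      = fun z => warpIntegrand θ V A Φ χ ε z + warpIntegrand θ V B Φ χ ε z := by
    intro ε
    ext1 z
    simp only [warpIntegrand, adjointX, LinearMap.comp_apply, LinearMap.add_apply, map_add,
      Submodule.coe_add, smul_add]
  refine ⟨fun ε hε => ?_, ?_⟩
  · rw [heq]
    exact ((h₁ χ hχ).1 ε hε).add ((h₂ χ hχ).1 ε hε)
  · refine ((h₁ χ hχ).2.add (h₂ χ hχ).2).congr' ?_
    filter_upwards [self_mem_nhdsWithin] with ε hε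
    rw [heq, integral_add ((h₁ χ hχ).1 ε hε) ((h₂ χ hχ).1 ε hε), smul_add]

lemma isWarped_of_forall_eq_zero
    {A : finiteParticle (shellMeasure n m) →ₗ[ℂ] finiteParticle (shellMeasure n m)}
    {Φ : finiteParticle (shellMeasure n m)}
    (h : ∀ x y : SpaceTime n, adjointX V x A (groupX V y Φ) = 0) : IsWarped θ V A Φ 0 := by
  intro χ _
  have heq : ∀ ε, warpIntegrand θ V A Φ χ ε = fun _ => 0 := by
    intro ε
    ext1 z
    rw [warpIntegrand, h, ZeroMemClass.coe_zero, smul_zero]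
  refine ⟨fun ε _ => ?_, ?_⟩
  · rw [heq]
    exact integrable_zero _ _ _
  · simp only [heq, integral_zero, smul_zero]
    exact tendsto_const_nhds

lemma isWarped_of_forall_inclSector
    {A B : finiteParticle (shellMeasure n m) →ₗ[ℂ] finiteParticle (shellMeasure n m)}
    (h : ∀ k (Ψ : Sector (shellMeasure n m) k), IsWarped θ V A (inclSector (shellMeasure n m) k Ψ)
      (B (inclSector (shellMeasure n m) k Ψ) : Fock (shellMeasure n m)))
    (Φ : finiteParticle (shellMeasure n m)) :
    IsWarped θ V A Φ (B Φ : Fock (shellMeasure n m)) := by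
  have hsum : ∀ K : ℕ, IsWarped θ V A
      (∑ k ∈ Finset.range K, inclSector (shellMeasure n m) k ((Φ : Fock (shellMeasure n m)) k))
      (B (∑ k ∈ Finset.range K, inclSector (shellMeasure n m) k
        ((Φ : Fock (shellMeasure n m)) k)) : Fock (shellMeasure n m)) := by
    intro K
    induction K with
    | zero =>
      rw [Finset.sum_range_zero, map_zero]
      exact isWarped_of_forall_eq_zero fun x y => by rw [map_zero, map_zero]
    | succ K ih =>
      rw [Finset.sum_range_succ, map_add]
      exact ih.add_right (h K _)
  obtain ⟨K, hK⟩ := exists_eq_sum_inclSector Φ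
  have := hsum K
  rwa [← hK] at this

/-- If the covariant orbit of `A` on `Φ` is the image under a bounded operator of an oscillating
family of phases, then `A` can be warped on `Φ`. -/
lemma isWarped_of_osc
    {A : finiteParticle (shellMeasure n m) →ₗ[ℂ] finiteParticle (shellMeasure n m)}
    {Φ : finiteParticle (shellMeasure n m)} {β : Type*} [MeasurableSpace β] {ν : Measure β}
    [SigmaFinite ν] {q Q : β → SpaceTime n} (hq : Measurable q) (hQ : Measurable Q)
    (Ω : Lp ℂ 2 ν) (L : Lp ℂ 2 ν →L[ℂ] Fock (shellMeasure n m))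
    (h : ∀ z : SpaceTime n × SpaceTime n,
      (adjointX V (Matrix.toEuclideanLin θ z.1) A (groupX V z.2 Φ) : Fock (shellMeasure n m))
        = L (phaseMul (measurable_oscPhase hq hQ z) Ω)) :
    IsWarped θ V A Φ (L (phaseMul (measurable_lorentz_pair hq hQ) Ω)) := by
  intro χ hχ
  have heq : ∀ ε, warpIntegrand θ V A Φ χ ε
      = fun z => L (oscWeight χ ε z • phaseMul (measurable_oscPhase hq hQ z) Ω) := by
    intro ε
    ext1 z
    rw [warpIntegrand, h, L.map_smul, oscWeight]
  refine ⟨fun ε hε => ?_, ?_⟩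
  · rw [heq]
    exact L.integrable_comp (integrable_osc χ hε hq hQ Ω)
  -- The bounded `L` passes through the Bochner integral where the integrand is integrable, that is
  -- for `ε ≠ 0`, which the punctured neighbourhood guarantees.
  · refine ((L.continuous.tendsto _).comp (tendsto_integral_osc χ hχ hq hQ Ω)).congr' ?_
    filter_upwards [self_mem_nhdsWithin] with ε hε
    rw [heq, L.integral_comp_comm (integrable_osc χ hε hq hQ Ω), Function.comp_apply]
    exact L.map_smul_of_tower _ _

/-! ### Orbits of creation and annihilation operators, and their deformations -/

lemma sectorGamma_translate1_neg (v : SpaceTime n) {k : ℕ} (Ψ : Sector (shellMeasure n m) k) :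
    sectorGamma (translate1 v).toLinearIsometry k
      (sectorGamma (translate1 (-v)).toLinearIsometry k Ψ) = Ψ := by
  have : (translate1 (-v) : H1 n m ≃ₗᵢ[ℂ] H1 n m) = (translate1 v).symm := by
    ext1 ψ
    rfl
  rw [this, sectorGamma_apply_symm]

lemma secondQuant_inclSector (W : H1 n m ≃ₗᵢ[ℂ] H1 n m) {k : ℕ} (Ψ : Sector (shellMeasure n m) k) :
    secondQuant W (inclSector _ k Ψ) = inclSector _ k (sectorGamma W.toLinearIsometry k Ψ) :=
  diagOp_inclSector _ Ψ

/-- Inner factors `Γ(V)Γ(V⁻¹)` cancel. Covariance moves `Γ(V)` and the translation by `v` into the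
argument of the creation operator, where the translation meets its inverse. -/
lemma adjointX_create_inclSector (h : H1 n m) (v y : SpaceTime n) {k : ℕ}
    (Ψ : Sector (shellMeasure n m) k) :
    adjointX V v (create h) (groupX V y (inclSector _ k Ψ))
      = inclSector _ (k + 1) (sectorGamma V.symm.toLinearIsometry (k + 1)
        (sectorCreate (translate1 v (V h)) k (sectorGamma (translate1 y).toLinearIsometry k
          (sectorGamma V.toLinearIsometry k Ψ)))) := by
  simp only [adjointX, groupX, LinearMap.comp_apply, secondQuant_inclSector, create,
    raiseOp_inclSector, ContinuousLinearMap.coe_coe, sectorGamma_apply_symm,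
    sectorGamma_sectorCreate, sectorGamma_translate1_neg]
  rfl

lemma adjointX_annihilate_inclSector (h : H1 n m) (v y : SpaceTime n) {k : ℕ}
    (Ψ : Sector (shellMeasure n m) (k + 1)) :
    adjointX V v (annihilate h) (groupX V y (inclSector _ (k + 1) Ψ))
      = inclSector _ k (sectorGamma V.symm.toLinearIsometry k
        ((sectorCreate (translate1 v (V h)) k).adjoint
          (sectorGamma (translate1 y).toLinearIsometry (k + 1)
            (sectorGamma V.toLinearIsometry (k + 1) Ψ)))) := by
  simp only [adjointX, groupX, LinearMap.comp_apply, secondQuant_inclSector, annihilate,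
    lowerOp_inclSector_succ, ContinuousLinearMap.coe_coe, sectorGamma_apply_symm,
    sectorGamma_sectorCreate_adjoint, sectorGamma_translate1_neg]

/-- `Γ(W)` on the `k`-particle sector, as a bounded operator into the Fock space. -/
def gammaIncl (W : H1 n m ≃ₗᵢ[ℂ] H1 n m) (k : ℕ) :
    Sector (shellMeasure n m) k →L[ℂ] Fock (shellMeasure n m) :=
  (lp.singleContinuousLinearMap ℂ (fun k : ℕ => Sector (shellMeasure n m) k) 2 k).comp
    (sectorGamma W.toLinearIsometry k)

lemma isWarped_create (hθ : IsLorentzSkew θ) (h : H1 n m)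
    (Φ : finiteParticle (shellMeasure n m)) :
    IsWarped θ V (create h) Φ (warpedCreate θ V h Φ : Fock (shellMeasure n m)) := by
  refine isWarped_of_forall_inclSector (fun k Ψ => ?_) Φ
  have := isWarped_of_osc (θ := θ) (V := V) (A := create h) (Φ := inclSector _ k Ψ)
    (measurable_leadMomentum m θ k).neg (measurable_totalMomentum_tail m k)
    (tensorCons (V h) (sectorGamma V.toLinearIsometry k Ψ : WaveFunction (shellMeasure n m) k))
    ((gammaIncl V.symm (k + 1)).comp (createProj (shellMeasure n m) k)) fun z => by
      rw [adjointX_create_inclSector, sectorCreate_translate1 hθ]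
      rfl
  convert this using 1
  rw [warpedCreate, LinearMap.comp_apply, LinearMap.comp_apply, secondQuant_inclSector,
    raiseOp_inclSector, secondQuant_inclSector]
  rfl

lemma isWarped_annihilate (hθ : IsLorentzSkew θ) (h : H1 n m)
    (Φ : finiteParticle (shellMeasure n m)) :
    IsWarped θ V (annihilate h) Φ (warpedAnnihilate θ V h Φ : Fock (shellMeasure n m)) := by
  refine isWarped_of_forall_inclSector (fun k Ψ => ?_) Φ
  cases k with
  -- The vacuum has no first particle, so no phase representation exists; both the orbit and the
  -- deformed vector are zero.
  | zero =>
    have h0 : warpedAnnihilate θ V h (inclSector _ 0 Ψ) = 0 := by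
      rw [warpedAnnihilate, LinearMap.comp_apply, LinearMap.comp_apply, secondQuant_inclSector,
        lowerOp_inclSector_zero, map_zero]
    rw [h0]
    refine isWarped_of_forall_eq_zero fun x y => ?_
    simp only [adjointX, groupX, LinearMap.comp_apply, secondQuant_inclSector, annihilate,
      lowerOp_inclSector_zero, map_zero]
  | succ k =>
    have := isWarped_of_osc (θ := θ) (V := V) (A := annihilate h) (Φ := inclSector _ (k + 1) Ψ)
      (measurable_leadMomentum m θ k) (measurable_totalMomentum m (k + 1))
      (sectorGamma V.toLinearIsometry (k + 1) Ψ : WaveFunction (shellMeasure n m) (k + 1))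
      ((gammaIncl V.symm k).comp (annihilateProj (V h) k)) fun z => by
        rw [adjointX_annihilate_inclSector, sectorCreate_adjoint_translate1 hθ]
        rfl
    convert this using 1
    rw [warpedAnnihilate, LinearMap.comp_apply, LinearMap.comp_apply, secondQuant_inclSector,
      lowerOp_inclSector_succ, secondQuant_inclSector]
    rfl

end Warp

end DeformedField

end

/-! ### The deformed field and its bounds -/

theorem mainTheorem8 (n : ℕ) (hn : 1 ≤ n) (m : ℝ) (hm : 0 < m)
    (θ : Matrix (Fin (n + 1)) (Fin (n + 1)) ℝ) (hθ : DeformedField.IsLorentzSkew θ)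
    (V : DeformedField.H1 n m ≃ₗᵢ[ℂ] DeformedField.H1 n m)
    (f : SchwartzMap (DeformedField.SpaceTime n) ℂ) :
    ∃ a aStar φ : DeformedField.DeltaX V →ₗ[ℂ] DeformedField.Fock (DeformedField.shellMeasure n m),
      ∀ Φ : DeformedField.DeltaX V,
        DeformedField.IsWarped θ V
          (DeformedField.annihilate (star (DeformedField.testMinus hm f))) Φ (a Φ) ∧
        DeformedField.IsWarped θ V
          (DeformedField.create (DeformedField.testPlus hm f)) Φ (aStar Φ) ∧
        DeformedField.IsWarped θ V (DeformedField.freeField hm f) Φ (φ Φ) ∧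
        φ Φ = a Φ + aStar Φ ∧
        ‖a Φ‖ ≤ ‖DeformedField.testMinus hm f‖ *
          ‖DeformedField.sqrtNumberAddOne (DeformedField.shellMeasure n m)
            (Φ : DeformedField.finiteParticle (DeformedField.shellMeasure n m))‖ ∧
        ‖aStar Φ‖ ≤ ‖DeformedField.testPlus hm f‖ *
          ‖DeformedField.sqrtNumberAddOne (DeformedField.shellMeasure n m)
            (Φ : DeformedField.finiteParticle (DeformedField.shellMeasure n m))‖ ∧
        ‖φ Φ‖ ≤ (‖DeformedField.testPlus hm f‖ + ‖DeformedField.testMinus hm f‖) *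
          ‖DeformedField.sqrtNumberAddOne (DeformedField.shellMeasure n m)
            (DeformedField.secondQuant V
              (Φ : DeformedField.finiteParticle (DeformedField.shellMeasure n m)))‖ ∧
        ‖DeformedField.sqrtNumberAddOne (DeformedField.shellMeasure n m)
            (DeformedField.secondQuant V
              (Φ : DeformedField.finiteParticle (DeformedField.shellMeasure n m)))‖ =
          ‖DeformedField.sqrtNumberAddOne (DeformedField.shellMeasure n m)
            (Φ : DeformedField.finiteParticle (DeformedField.shellMeasure n m))‖ := by
  set a' := DeformedField.warpedAnnihilate θ V (star (DeformedField.testMinus hm f))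
  set c' := DeformedField.warpedCreate θ V (DeformedField.testPlus hm f)
  refine ⟨(DeformedField.finiteParticle _).subtype ∘ₗ a' ∘ₗ (DeformedField.DeltaX V).subtype,
    (DeformedField.finiteParticle _).subtype ∘ₗ c' ∘ₗ (DeformedField.DeltaX V).subtype,
    (DeformedField.finiteParticle _).subtype ∘ₗ (a' + c') ∘ₗ (DeformedField.DeltaX V).subtype,
    fun Φ => ?_⟩
  have hw₁ := DeformedField.isWarped_annihilate (V := V) hθ
    (star (DeformedField.testMinus hm f)) Φ
  have hw₂ := DeformedField.isWarped_create (V := V) hθ (DeformedField.testPlus hm f) Φ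
  have hn₁ := DeformedField.norm_warpedAnnihilate_le (θ := θ) (V := V)
    (star (DeformedField.testMinus hm f)) Φ
  have hn₂ := DeformedField.norm_warpedCreate_le (θ := θ) (V := V) (DeformedField.testPlus hm f) Φ
  -- The annihilator carries the conjugate of `f⁻`, which has the same norm as `f⁻`.
  rw [DeformedField.norm_star_Lp] at hn₁
  refine ⟨hw₁, hw₂, hw₁.add_op hw₂, rfl, hn₁, hn₂, ?_,
    DeformedField.norm_sqrtNumberAddOne_secondQuant V _⟩
  rw [DeformedField.norm_sqrtNumberAddOne_secondQuant, add_comm ‖_‖, add_mul]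
  exact (norm_add_le _ _).trans (add_le_add hn₁ hn₂)
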